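/- Let $\Gamma$ be an $n$-space group, i.e. a discrete group of isometries of Euclidean $n$-space $E^n$ whose orbit space $E^n/\Gamma$ is compact. Equip $E^n/\Gamma$ with the orbit-space metric $d(\Gamma x,\Gamma y)=\inf_{\gamma\in\Gamma}|x-\gamma y|$, let $\mathrm{Isom}(E^n/\Gamma)$ be its isometry group with the compact-open topology, and let $K$ be the connected component of the identity in $\mathrm{Isom}(E^n/\Gamma)$. A map $\alpha:E^n\to E^n$ is a lift of $\beta:E^n/\Gamma\to E^n/\Gamma$ if $\beta(\Gamma x)=\Gamma\alpha(x)$ for all $x\in E^n$. Let $\mathrm{Aff}(E^n/\Gamma)$ be the group of bijections of $E^n/\Gamma$ that have a lift which is an affinity $x\mapsto a+Ax$ of $E^n$ ($a\in E^n$, $A\in\mathrm{GL}(n,\mathbb R)$). Let $\mathrm{Out}(\Gamma)=\mathrm{Aut}(\Gamma)/\mathrm{Inn}(\Gamma)$ and $\mathrm{Out}_E(\Gamma)=\mathrm{Aut}_E(\Gamma)/\mathrm{Inn}(\Gamma)$, where $\mathrm{Aut}_E(\Gamma)$ is the group of automorphisms of $\Gamma$ that are conjugation by an isometry of $E^n$.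 (1) For each $\beta\in\mathrm{Aff}(E^n/\Gamma)$ and each affine lift $\tilde\beta$ of $\beta$, one has $\tilde\beta\Gamma\tilde\beta^{-1}=\Gamma$, and the class $\Omega(\beta)\in\mathrm{Out}(\Gamma)$ of the automorphism $\gamma\mapsto\tilde\beta\gamma\tilde\beta^{-1}$ depends only on $\beta$. The map $\Omega:\mathrm{Aff}(E^n/\Gamma)\to\mathrm{Out}(\Gamma)$ is an epimorphism of groups, and its kernel is $K$ (isometries of $E^n/\Gamma$ being regarded as bijections of $E^n/\Gamma$). (2) Each $\zeta\in\mathrm{Isom}(E^n/\Gamma)$ has a lift which is an isometry of $E^n$. For each such lift $\tilde\zeta$, one has $\tilde\zeta\Gamma\tilde\zeta^{-1}=\Gamma$, and the class in $\mathrm{Out}_E(\Gamma)$ of $\gamma\mapsto\tilde\zeta\gamma\tilde\zeta^{-1}$ depends only on $\zeta$. The resulting map $\mathrm{Isom}(E^n/\Gamma)\to\mathrm{Out}_E(\Gamma)$ is an epimorphism of groups with kernel $K$ (so $\mathrm{Isom}(E^n/\Gamma)/K\cong\mathrm{Out}_E(\Gamma)$), and $\mathrm{Out}_E(\Gamma)$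 is a finite group. -/

import Mathlib

open Topology

namespace SpaceGroup

section Isometries

variable {X : Type*} [PseudoMetricSpace X]

/-- The group of isometries of `X` carries the compact-open topology, i.e. the subspace topology
inherited from the space `C(X, X)` of continuous self-maps of `X`. -/
instance isomTopology : TopologicalSpace (X ≃ᵢ X) :=
  TopologicalSpace.induced (fun g => (⟨g, g.continuous⟩ : C(X, X))) inferInstance

/-- On the isometry group the compact-open topology is that of pointwise convergence. -/
theorem tendsto_isom_iff {ι : Type*} {p : Filter ι} {F : ι → (X ≃ᵢ X)} {f : X ≃ᵢ X} :
    Filter.Tendsto F p (𝓝 f) ↔ ∀ x, Filter.Tendsto (fun i => F i x) p (𝓝 (f x)) := by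
  have hind : Topology.IsInducing (fun g : X ≃ᵢ X => (⟨g, g.continuous⟩ : C(X, X))) := ⟨rfl⟩
  rw [hind.tendsto_nhds_iff]
  constructor
  · intro h x
    exact ((ContinuousEvalConst.continuous_eval_const (F := C(X, X)) x).tendsto _).comp h
  · intro h
    rw [ContinuousMap.tendsto_iff_forall_isCompact_tendstoUniformlyOn]
    intro K hK
    rw [← tendstoLocallyUniformlyOn_iff_tendstoUniformlyOn_of_compact hK,
      Metric.tendstoLocallyUniformlyOn_iff]
    intro ε hε x _
    refine ⟨Metric.ball x (ε / 3), mem_nhdsWithin_of_mem_nhds (Metric.ball_mem_nhds x (by positivity)),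
      ?_⟩
    filter_upwards [Metric.tendsto_nhds.1 (h x) (ε / 3) (by positivity)] with i hi y hy
    have h1 : dist (f y) (f x) < ε / 3 := by rw [f.dist_eq]; exact hy
    have h2 : dist (F i x) (F i y) < ε / 3 := by
      rw [(F i).dist_eq, dist_comm]; exact hy
    have h3 : dist (f x) (F i x) < ε / 3 := by rw [dist_comm]; exact hi
    calc dist (f y) (F i y) ≤ dist (f y) (f x) + dist (f x) (F i x) + dist (F i x) (F i y) :=
          dist_triangle4 _ _ _ _
      _ < ε := by linarith

instance isomTopologicalGroup : IsTopologicalGroup (X ≃ᵢ X) where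
  continuous_mul := by
    rw [continuous_iff_continuousAt]
    rintro ⟨f, g⟩
    refine tendsto_isom_iff.2 fun x => ?_
    have hf : Filter.Tendsto (fun p : (X ≃ᵢ X) × (X ≃ᵢ X) => p.1 (g x)) (𝓝 (f, g))
        (𝓝 (f (g x))) := tendsto_isom_iff.1 (continuous_fst.tendsto (f, g)) (g x)
    have hg : Filter.Tendsto (fun p : (X ≃ᵢ X) × (X ≃ᵢ X) => p.2 x) (𝓝 (f, g))
        (𝓝 (g x)) := tendsto_isom_iff.1 (continuous_snd.tendsto (f, g)) x
    rw [tendsto_iff_dist_tendsto_zero] at hf hg ⊢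
    refine squeeze_zero (fun _ => dist_nonneg) (fun p => ?_) (by simpa using hg.add hf)
    calc dist ((p.1 * p.2) x) ((f * g) x)
        ≤ dist (p.1 (p.2 x)) (p.1 (g x)) + dist (p.1 (g x)) (f (g x)) := dist_triangle _ _ _
      _ = dist (p.2 x) (g x) + dist (p.1 (g x)) (f (g x)) := by rw [p.1.dist_eq]
  continuous_inv := by
    rw [continuous_iff_continuousAt]
    intro f
    refine tendsto_isom_iff.2 fun x => ?_
    have hf : Filter.Tendsto (fun g : X ≃ᵢ X => g (f⁻¹ x)) (𝓝 f) (𝓝 (f (f⁻¹ x))) :=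
      tendsto_isom_iff.1 Filter.tendsto_id (f⁻¹ x)
    rw [tendsto_iff_dist_tendsto_zero] at hf ⊢
    refine hf.congr fun g => ?_
    rw [IsometryEquiv.apply_inv_self, ← g.dist_eq (g⁻¹ x), IsometryEquiv.apply_inv_self, dist_comm]

/-- The permutation underlying an isometry. -/
def toPerm : (X ≃ᵢ X) →* Equiv.Perm X where
  toFun g := g.toEquiv
  map_one' := rfl
  map_mul' _ _ := rfl

/-- The tautological action of the isometry group. -/
instance isomAction : MulAction (X ≃ᵢ X) X where
  smul g x := g x
  one_smul _ := rfl
  mul_smul _ _ _ := rfl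

/-- The orbit space `X/Γ`. -/
def OrbitSpace (Γ : Subgroup (X ≃ᵢ X)) : Type _ := MulAction.orbitRel.Quotient Γ X

variable {Γ : Subgroup (X ≃ᵢ X)}

/-- The quotient map `x ↦ Γx`. -/
def OrbitSpace.mk (Γ : Subgroup (X ≃ᵢ X)) (x : X) : OrbitSpace Γ :=
  Quotient.mk (MulAction.orbitRel Γ X) x

/-- The quotient topology. -/
instance orbitTopology : TopologicalSpace (OrbitSpace Γ) :=
  inferInstanceAs (TopologicalSpace (Quotient (MulAction.orbitRel Γ X)))

theorem OrbitSpace.mk_surjective : Function.Surjective (OrbitSpace.mk Γ) :=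
  Quotient.mk_surjective

theorem OrbitSpace.mk_eq_iff {x y : X} :
    OrbitSpace.mk Γ x = OrbitSpace.mk Γ y ↔ ∃ γ : Γ, (γ : X ≃ᵢ X) y = x :=
  Quotient.eq (r := MulAction.orbitRel Γ X)

theorem bddBelow_dist (x y : X) :
    BddBelow (Set.range fun γ : Γ => dist x ((γ : X ≃ᵢ X) y)) :=
  ⟨0, by rintro _ ⟨γ, rfl⟩; exact dist_nonneg⟩

theorem iInf_dist_smul (x y : X) (a b : Γ) :
    ⨅ γ : Γ, dist ((a : X ≃ᵢ X) x) ((γ : X ≃ᵢ X) ((b : X ≃ᵢ X) y))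
      = ⨅ γ : Γ, dist x ((γ : X ≃ᵢ X) y) := by
  refine Function.Surjective.iInf_congr (fun γ : Γ => a⁻¹ * γ * b)
    (fun γ => ⟨a * γ * b⁻¹, by group⟩) fun γ => ?_
  rw [← (a : X ≃ᵢ X).dist_eq x]
  simp [IsometryEquiv.mul_apply]

/-- The distance between two orbits: the infimum of the distances of their points. -/
noncomputable def orbitDist (p q : OrbitSpace Γ) : ℝ :=
  Quotient.liftOn₂ p q (fun x y => ⨅ γ : Γ, dist x ((γ : X ≃ᵢ X) y)) (by
    rintro x y x' y' ⟨a, rfl⟩ ⟨b, rfl⟩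
    exact iInf_dist_smul x' y' a b)

theorem orbitDist_mk (x y : X) :
    orbitDist (OrbitSpace.mk Γ x) (OrbitSpace.mk Γ y) = ⨅ γ : Γ, dist x ((γ : X ≃ᵢ X) y) := rfl

theorem orbitDist_lt_iff {x y : X} {r : ℝ} :
    orbitDist (OrbitSpace.mk Γ x) (OrbitSpace.mk Γ y) < r
      ↔ ∃ γ : Γ, dist x ((γ : X ≃ᵢ X) y) < r := by
  rw [orbitDist_mk]
  exact ⟨exists_lt_of_ciInf_lt, fun ⟨γ, h⟩ => (ciInf_le (bddBelow_dist x y) γ).trans_lt h⟩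

/-- The orbit space with the orbit distance and the quotient topology. When `Γ` is discrete the
orbits are closed, so that this is a metric space. -/
noncomputable instance orbitMetric : PseudoMetricSpace (OrbitSpace Γ) :=
  PseudoMetricSpace.ofDistTopology orbitDist
    (by
      intro p
      obtain ⟨x, rfl⟩ := OrbitSpace.mk_surjective p
      refine le_antisymm ?_ (Real.iInf_nonneg fun _ => dist_nonneg)
      rw [orbitDist_mk]
      simpa using ciInf_le (bddBelow_dist (Γ := Γ) x x) 1)
    (by
      intro p q
      obtain ⟨x, rfl⟩ := OrbitSpace.mk_surjective p
      obtain ⟨y, rfl⟩ := OrbitSpace.mk_surjective q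
      rw [orbitDist_mk, orbitDist_mk]
      refine Function.Surjective.iInf_congr (fun γ : Γ => γ⁻¹)
        (fun γ => ⟨γ⁻¹, inv_inv γ⟩) fun γ => ?_
      rw [← (γ : X ≃ᵢ X).dist_eq y]
      simp [dist_comm])
    (by
      intro p q r
      obtain ⟨x, rfl⟩ := OrbitSpace.mk_surjective p
      obtain ⟨y, rfl⟩ := OrbitSpace.mk_surjective q
      obtain ⟨z, rfl⟩ := OrbitSpace.mk_surjective r
      refine le_of_forall_pos_lt_add fun ε hε => ?_
      obtain ⟨a, ha⟩ := orbitDist_lt_iff.1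
        (lt_add_of_pos_right (orbitDist (OrbitSpace.mk Γ x) (OrbitSpace.mk Γ y)) (half_pos hε))
      obtain ⟨b, hb⟩ := orbitDist_lt_iff.1
        (lt_add_of_pos_right (orbitDist (OrbitSpace.mk Γ y) (OrbitSpace.mk Γ z)) (half_pos hε))
      refine orbitDist_lt_iff.2 ⟨a * b, ?_⟩
      have h : dist ((a : X ≃ᵢ X) y) (((a * b : Γ) : X ≃ᵢ X) z) = dist y ((b : X ≃ᵢ X) z) := by
        rw [← (a : X ≃ᵢ X).dist_eq y]; rfl
      have := dist_triangle x ((a : X ≃ᵢ X) y) (((a * b : Γ) : X ≃ᵢ X) z)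
      linarith)
    (by
      intro s
      have hq : IsOpen s ↔ IsOpen (OrbitSpace.mk Γ ⁻¹' s) := Iff.rfl
      rw [hq, Metric.isOpen_iff]
      constructor
      · intro h p hp
        obtain ⟨x, rfl⟩ := OrbitSpace.mk_surjective p
        obtain ⟨ε, hε, hs⟩ := h x hp
        refine ⟨ε, hε, fun q hq => ?_⟩
        obtain ⟨y, rfl⟩ := OrbitSpace.mk_surjective q
        obtain ⟨γ, hγ⟩ := orbitDist_lt_iff.1 hq
        have h1 : (γ : X ≃ᵢ X) y ∈ OrbitSpace.mk Γ ⁻¹' s := hs (by rwa [Metric.mem_ball, dist_comm])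
        have h2 : OrbitSpace.mk Γ ((γ : X ≃ᵢ X) y) = OrbitSpace.mk Γ y :=
          OrbitSpace.mk_eq_iff.2 ⟨γ, rfl⟩
        rwa [Set.mem_preimage, h2] at h1
      · intro h x hx
        obtain ⟨ε, hε, hs⟩ := h _ hx
        refine ⟨ε, hε, fun y hy => hs _ (orbitDist_lt_iff.2 ⟨1, ?_⟩)⟩
        simpa [dist_comm] using hy)

/-- The map `α` of `X` is a lift of the map `β` of `X/Γ`. -/
def IsLift (Γ : Subgroup (X ≃ᵢ X)) (α : X → X) (β : OrbitSpace Γ → OrbitSpace Γ) : Prop :=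
  ∀ x, β (OrbitSpace.mk Γ x) = OrbitSpace.mk Γ (α x)

/-- The automorphism `φ` of `Γ` is `γ ↦ α γ α⁻¹` (in particular `α Γ α⁻¹ = Γ`). -/
def IsConjugationBy (α : Equiv.Perm X) (φ : MulAut Γ) : Prop :=
  ∀ γ : Γ, toPerm (φ γ : X ≃ᵢ X) = α * toPerm (γ : X ≃ᵢ X) * α⁻¹

end Isometries

section Automorphisms

/-- The group of inner automorphisms. -/
def Inn (G : Type*) [Group G] : Subgroup (MulAut G) := (MulAut.conj : G →* MulAut G).range

instance Inn_normal (G : Type*) [Group G] : (Inn G).Normal where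
  conj_mem := by
    rintro _ ⟨g, rfl⟩ φ
    refine ⟨φ g, ?_⟩
    ext h
    simp

/-- The group of outer automorphisms. -/
abbrev Out (G : Type*) [Group G] : Type _ := MulAut G ⧸ Inn G

end Automorphisms

/-- Euclidean `n`-space. -/
abbrev E (n : ℕ) : Type := EuclideanSpace ℝ (Fin n)

/-- An `n`-space group: a discrete group of isometries of `E n` with compact orbit space. -/
structure IsSpaceGroup {n : ℕ} (Γ : Subgroup (E n ≃ᵢ E n)) : Prop where
  discrete : DiscreteTopology Γ
  compact : CompactSpace (OrbitSpace Γ)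

variable {n : ℕ} (Γ : Subgroup (E n ≃ᵢ E n))

/-- The group of isometries of `E^n/Γ`. -/
abbrev IsomOrbit : Type := OrbitSpace Γ ≃ᵢ OrbitSpace Γ

/-- The group of affinities of `E^n/Γ`: the bijections of `E^n/Γ` that lift to an affinity
of `E n`. -/
def AffOrbit : Subgroup (Equiv.Perm (OrbitSpace Γ)) where
  carrier := {β | ∃ α : E n ≃ᵃ[ℝ] E n, IsLift Γ α β}
  one_mem' := ⟨AffineEquiv.refl ℝ _, fun _ => rfl⟩
  mul_mem' := by
    rintro β β' ⟨α, h⟩ ⟨α', h'⟩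
    refine ⟨α'.trans α, fun x => ?_⟩
    rw [Equiv.Perm.mul_apply, h' x, h (α' x)]
    rfl
  inv_mem' := by
    rintro β ⟨α, h⟩
    refine ⟨α.symm, fun x => ?_⟩
    rw [Equiv.Perm.inv_eq_iff_eq, h, AffineEquiv.apply_symm_apply]

/-- The group of Euclidean automorphisms of `Γ`: those that are conjugation by an isometry
of `E n`. -/
def AutE : Subgroup (MulAut Γ) where
  carrier := {φ | ∃ g : E n ≃ᵢ E n, IsConjugationBy (toPerm g) φ}
  one_mem' := ⟨1, fun γ => by simp⟩
  mul_mem' := by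
    rintro φ ψ ⟨g, hg⟩ ⟨h, hh⟩
    refine ⟨g * h, fun γ => ?_⟩
    rw [MulAut.mul_apply, hg, hh, map_mul]
    group
  inv_mem' := by
    rintro φ ⟨g, hg⟩
    refine ⟨g⁻¹, fun γ => ?_⟩
    have := hg (φ⁻¹ γ)
    rw [MulAut.apply_inv_self] at this
    rw [this, map_inv]
    group

/-- Inner automorphisms are Euclidean. -/
theorem Inn_le_AutE : Inn Γ ≤ AutE Γ := by
  rintro _ ⟨g, rfl⟩
  refine ⟨g, fun γ => ?_⟩
  simp [MulAut.conj_apply]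

/-- The group of Euclidean outer automorphisms of `Γ`. -/
abbrev OutE : Type := AutE Γ ⧸ (Inn Γ).subgroupOf (AutE Γ)

/-- The connected component of the identity of the topological group of isometries of `E^n/Γ`. -/
noncomputable abbrev IdComponent : Subgroup (IsomOrbit Γ) := Subgroup.connectedComponentOfOne (IsomOrbit Γ)

variable {Γ}

/-- The homomorphism `Ω` sends each affinity `β` of `E^n/Γ` to the class of conjugation by
any affinity of `E n` lifting `β`. -/
def IsOmega (Ω : AffOrbit Γ →* Out Γ) : Prop :=
  ∀ (β : AffOrbit Γ) (α : E n ≃ᵃ[ℝ] E n), IsLift Γ α (β : Equiv.Perm (OrbitSpace Γ)) →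
    ∃ φ : MulAut Γ, IsConjugationBy α.toEquiv φ ∧ Ω β = (φ : Out Γ)

/-- The homomorphism `Ω` sends each isometry `ζ` of `E^n/Γ` to the class of conjugation by
any isometry of `E n` lifting `ζ`. -/
def IsOmegaE (Ω : IsomOrbit Γ →* OutE Γ) : Prop :=
  ∀ (ζ : IsomOrbit Γ) (g : E n ≃ᵢ E n), IsLift Γ g ζ →
    ∃ φ : AutE Γ, IsConjugationBy (toPerm g) (φ : MulAut Γ) ∧ Ω ζ = (φ : OutE Γ)

end SpaceGroup

open SpaceGroup

namespace SpaceGroup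

/-! ### Discrete groups of isometries and properly discontinuous actions -/

section General

/-! Write Γ for the space group. Its orbits are countable, so an affinity lifting the identity
agrees with some element of Γ on an open set, by Baire, and therefore lies in Γ. Hence affine lifts
normalize Γ, and two lifts of one map differ by an element of Γ. This makes both homomorphisms well
defined.

Surjectivity of Ω is Bieberbach's rigidity theorem. A commutator argument
(`rot_eq_one_of_defect_le`) shows that elements of Γ with small rotation are translations. So the
translation lattice spans and the point group is finite. An automorphism is then linear on the
lattice, and averaging a cocycle over the point group realizes it by an affinity
(`exists_affineEquiv_of_mulAut`).

An isometry of the orbit space lifts locally, near points with trivial stabilizer. The local lift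
extends to an isometry of Euclidean space, and `coincidence_eq_univ` shows that the extension is a
lift everywhere (`exists_isometric_lift`).

Both kernels and K turn out to be the same set of maps: those lifted by a translation along a vector
fixed by the point group. For the kernels, a lift inducing an inner automorphism can be corrected by
an element of Γ until it centralizes Γ, and the centralizer consists of such translations. For K,
these translations form connected one-parameter families. Conversely, an isometry near the identity
has a lift near the identity; that lift normalizes the finitely generated discrete group Γ, so it
centralizes it, and the kernel is open (`mem_idComponent_iff`). The same rigidity near the identity,
together with compactness, makes the Euclidean outer automorphism group finite. -/

theorem finite_of_isBounded_of_separated {X : Type*} [MetricSpace X] [ProperSpace X] {s : Set X}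
    (hs : Bornology.IsBounded s) {ε : ℝ} (hε : 0 < ε)
    (h : ∀ x ∈ s, ∀ y ∈ s, dist x y < ε → x = y) : s.Finite := by
  by_contra hinf
  let f : ℕ → s := Set.Infinite.natEmbedding s hinf
  have hf : Function.Injective f := (Set.Infinite.natEmbedding s hinf).injective
  obtain ⟨a, -, φ, hφ, ha⟩ := tendsto_subseq_of_bounded hs (fun k => (f k).2)
  obtain ⟨N, hN⟩ := Metric.cauchySeq_iff.1 ha.cauchySeq ε hε
  have := h _ (f (φ N)).2 _ (f (φ (N + 1))).2 (hN N le_rfl (N + 1) (Nat.le_succ N))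
  exact absurd (hφ.injective (hf (Subtype.ext this))) (by simp)

theorem tendsto_isom_self {X : Type*} [PseudoMetricSpace X] (x : X) (f : X ≃ᵢ X) :
    Filter.Tendsto (fun g : X ≃ᵢ X => g x) (𝓝 f) (𝓝 (f x)) :=
  tendsto_isom_iff.1 Filter.tendsto_id x

theorem nhds_isom {X : Type*} [PseudoMetricSpace X] (f : X ≃ᵢ X) :
    𝓝 f = Filter.comap (fun g : X ≃ᵢ X => (g : X → X)) (𝓝 (f : X → X)) := by
  apply le_antisymm
  · rw [← Filter.tendsto_iff_comap, tendsto_pi_nhds]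
    exact fun x => tendsto_isom_self x f
  · rw [← Filter.tendsto_id', tendsto_isom_iff]
    exact fun x => tendsto_pi_nhds.1 Filter.tendsto_comap x

theorem exists_finset_of_mem_nhds_one {X : Type*} [PseudoMetricSpace X] {U : Set (X ≃ᵢ X)}
    (hU : U ∈ 𝓝 1) : ∃ (I : Finset X) (ε : ℝ), 0 < ε ∧
      ∀ g : X ≃ᵢ X, (∀ x ∈ I, dist (g x) x < ε) → g ∈ U := by
  rw [nhds_isom, nhds_pi, Filter.mem_comap] at hU
  obtain ⟨t, ht, htU⟩ := hU
  rw [Filter.mem_pi] at ht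
  obtain ⟨I, hI, V, hV, hVt⟩ := ht
  have : ∀ x, ∃ ε > 0, Metric.ball x ε ⊆ V x := fun x => Metric.mem_nhds_iff.1 (hV x)
  choose ε hε hεV using this
  obtain ⟨δ, hδ, hδI⟩ : ∃ δ > 0, ∀ x ∈ I, δ ≤ ε x := by
    obtain rfl | hne := I.eq_empty_or_nonempty
    · exact ⟨1, one_pos, by simp⟩
    · obtain ⟨a, -, ha⟩ := Set.exists_min_image I ε hI hne
      exact ⟨ε a, hε a, ha⟩
  refine ⟨hI.toFinset, δ, hδ, fun g hg => htU (hVt fun x hx => hεV x ?_)⟩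
  exact (hg x (hI.mem_toFinset.2 hx)).trans_le (hδI x hx)

/-- An Arzelà–Ascoli substitute: a neighbourhood of 1 only constrains finitely many points, and
evaluation at those points embeds `S` as a bounded separated subset of a proper space. -/
theorem finite_of_separated_isom {X : Type*} [MetricSpace X] [ProperSpace X]
    {S : Set (X ≃ᵢ X)} {x₀ : X} {r : ℝ} (hS : ∀ g ∈ S, dist (g x₀) x₀ ≤ r)
    {U : Set (X ≃ᵢ X)} (hU : U ∈ 𝓝 1)
    (h : ∀ g ∈ S, ∀ g' ∈ S, g⁻¹ * g' ∈ U → g = g') : S.Finite := by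
  obtain ⟨I, ε, hε, hI⟩ := exists_finset_of_mem_nhds_one hU
  let F : (X ≃ᵢ X) → (I → X) := fun g x => g x
  have key : ∀ g ∈ S, ∀ g' ∈ S, dist (F g) (F g') < ε → g = g' := by
    intro g hg g' hg' hd
    refine h g hg g' hg' (hI _ fun x hx => ?_)
    rw [← g.dist_eq]
    have := (dist_pi_lt_iff hε).1 hd ⟨x, hx⟩
    rw [dist_comm]
    simpa [F, IsometryEquiv.mul_apply] using this
  have hinj : Set.InjOn F S := fun g hg g' hg' e =>
    key g hg g' hg' (by rw [e, dist_self]; exact hε)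
  refine Set.Finite.of_finite_image ?_ hinj
  refine finite_of_isBounded_of_separated (ε := ε) ?_ hε ?_
  · rw [Metric.isBounded_iff_subset_closedBall (fun x : I => (x : X))]
    obtain ⟨R, hR⟩ : ∃ R, ∀ x ∈ I, dist x x₀ ≤ R := by
      obtain ⟨R, hR⟩ := (I.finite_toSet.isBounded).subset_closedBall x₀
      exact ⟨R, fun x hx => hR hx⟩
    refine ⟨max 0 (R + r + R), ?_⟩
    rintro _ ⟨g, hg, rfl⟩
    rw [Metric.mem_closedBall, dist_pi_le_iff (le_max_left _ _)]
    rintro ⟨x, hx⟩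
    refine le_trans ?_ (le_max_right _ _)
    calc dist (g x) x ≤ dist (g x) (g x₀) + dist (g x₀) x₀ + dist x₀ x := dist_triangle4 _ _ _ _
      _ ≤ R + r + R := by
        rw [g.dist_eq, dist_comm x₀ x]
        have := hR x hx; have := hS g hg; linarith
  · rintro _ ⟨g, hg, rfl⟩ _ ⟨g', hg', rfl⟩ hd
    rw [key g hg g' hg' hd]

/-- Every point has only finitely many translates in each ball, counted with multiplicity. -/
def IsProperlyDiscontinuous {X : Type*} [PseudoMetricSpace X] (Γ : Subgroup (X ≃ᵢ X)) : Prop :=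
  ∀ x r, {g | g ∈ Γ ∧ dist (g x) x ≤ r}.Finite

theorem isProperlyDiscontinuous_of_discreteTopology {X : Type*} [MetricSpace X] [ProperSpace X]
    {Γ : Subgroup (X ≃ᵢ X)} (hΓ : DiscreteTopology Γ) : IsProperlyDiscontinuous Γ := by
  intro x r
  have h1 : ({1} : Set Γ) ∈ 𝓝 (1 : Γ) := by simp
  rw [nhds_subtype, Filter.mem_comap] at h1
  obtain ⟨U, hU, hU1⟩ := h1
  refine finite_of_separated_isom (r := r) (x₀ := x) (fun g hg => hg.2) hU ?_
  intro g hg g' hg' hgU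
  have := hU1 (show (⟨g⁻¹ * g', Γ.mul_mem (Γ.inv_mem hg.1) hg'.1⟩ : Γ) ∈ _ from hgU)
  have := congrArg Subtype.val (Set.mem_singleton_iff.1 this)
  exact (inv_mul_eq_one.1 this)

namespace IsProperlyDiscontinuous

variable {X : Type*} [PseudoMetricSpace X] {Γ : Subgroup (X ≃ᵢ X)}

theorem finite_dist_le (h : IsProperlyDiscontinuous Γ) (x y : X) (r : ℝ) :
    {g | g ∈ Γ ∧ dist (g x) y ≤ r}.Finite :=
  (h x (r + dist y x)).subset fun g hg =>
    ⟨hg.1, (dist_triangle _ y _).trans (by linarith [hg.2])⟩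

theorem exists_isMin (h : IsProperlyDiscontinuous Γ) (x y : X) {S : Set (X ≃ᵢ X)}
    (hS : S ⊆ Γ) (hne : S.Nonempty) : ∃ g ∈ S, ∀ g' ∈ S, dist (g x) y ≤ dist (g' x) y := by
  obtain ⟨g₀, hg₀⟩ := hne
  obtain ⟨g, hg, hmin⟩ := Set.exists_min_image {g | g ∈ S ∧ dist (g x) y ≤ dist (g₀ x) y}
    (fun g => dist (g x) y) ((h.finite_dist_le x y (dist (g₀ x) y)).subset
      fun g hg => ⟨hS hg.1, hg.2⟩) ⟨g₀, hg₀, le_rfl⟩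
  refine ⟨g, hg.1, fun g' hg' => ?_⟩
  by_cases hle : dist (g' x) y ≤ dist (g₀ x) y
  · exact hmin g' ⟨hg', hle⟩
  · exact hg.2.trans (not_le.1 hle).le

theorem countable (h : IsProperlyDiscontinuous Γ) : Countable Γ := by
  by_cases hX : Nonempty X
  · obtain ⟨x⟩ := hX
    have : (Γ : Set (X ≃ᵢ X)) ⊆ ⋃ k : ℕ, {g | g ∈ Γ ∧ dist (g x) x ≤ k} := fun g hg => by
      obtain ⟨k, hk⟩ := exists_nat_ge (dist (g x) x)
      exact Set.mem_iUnion.2 ⟨k, hg, hk⟩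
    exact (Set.Countable.mono this (Set.countable_iUnion fun k => (h x k).countable)).to_subtype
  · rw [not_nonempty_iff] at hX
    have : Subsingleton (X ≃ᵢ X) := ⟨fun f g => IsometryEquiv.ext fun x => isEmptyElim x⟩
    infer_instance

/-- Elements of the group moving a point only slightly fix it. -/
theorem exists_fix_radius {X : Type*} [MetricSpace X] {Γ : Subgroup (X ≃ᵢ X)}
    (h : IsProperlyDiscontinuous Γ) (x : X) :
    ∃ r > 0, ∀ g ∈ Γ, dist (g x) x < r → g x = x := by
  by_cases hne : {g | g ∈ Γ ∧ g x ≠ x}.Nonempty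
  · obtain ⟨g, hg, hmin⟩ := h.exists_isMin x x (fun g hg => hg.1) hne
    refine ⟨dist (g x) x, dist_pos.2 hg.2, fun g' hg' hlt => ?_⟩
    by_contra hcon
    exact absurd (hmin g' ⟨hg', hcon⟩) (not_le.2 hlt)
  · refine ⟨1, one_pos, fun g hg _ => ?_⟩
    by_contra hcon
    exact hne ⟨g, hg, hcon⟩

/-- The distance of two orbits is attained. -/
theorem exists_dist_eq (h : IsProperlyDiscontinuous Γ) (x y : X) :
    ∃ g ∈ Γ, dist (OrbitSpace.mk Γ x) (OrbitSpace.mk Γ y) = dist (g x) y := by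
  obtain ⟨g, hg, hmin⟩ := h.exists_isMin x y (S := Γ) subset_rfl ⟨1, Γ.one_mem⟩
  refine ⟨g, hg, ?_⟩
  rw [dist_comm]
  refine le_antisymm ?_ ?_
  · have := ciInf_le (bddBelow_dist (Γ := Γ) y x) ⟨g, hg⟩
    rw [dist_comm (g x)]
    exact this
  · refine le_ciInf fun γ => ?_
    rw [dist_comm y]
    exact hmin γ γ.2

end IsProperlyDiscontinuous

variable {X : Type*} [PseudoMetricSpace X] {Γ : Subgroup (X ≃ᵢ X)}

theorem dist_mk_le (x y : X) {g : X ≃ᵢ X} (hg : g ∈ Γ) :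
    dist (OrbitSpace.mk Γ x) (OrbitSpace.mk Γ y) ≤ dist (g x) y := by
  rw [dist_comm, dist_comm (g x)]
  exact ciInf_le (bddBelow_dist (Γ := Γ) y x) ⟨g, hg⟩

theorem mk_apply {g : X ≃ᵢ X} (hg : g ∈ Γ) (x : X) :
    OrbitSpace.mk Γ (g x) = OrbitSpace.mk Γ x :=
  OrbitSpace.mk_eq_iff.2 ⟨⟨g, hg⟩, rfl⟩

theorem mk_eq_of_dist_eq_zero {X : Type*} [MetricSpace X] {Γ : Subgroup (X ≃ᵢ X)}
    (h : IsProperlyDiscontinuous Γ) {x y : X}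
    (hd : dist (OrbitSpace.mk Γ x) (OrbitSpace.mk Γ y) = 0) :
    OrbitSpace.mk Γ x = OrbitSpace.mk Γ y := by
  obtain ⟨g, hg, hgd⟩ := h.exists_dist_eq x y
  rw [hd, eq_comm, dist_eq_zero] at hgd
  rw [← mk_apply hg, hgd]

theorem continuous_mk : Continuous (OrbitSpace.mk Γ) := continuous_quotient_mk'

end General

/-! ### Linear parts and translations -/

section Rotation

variable {n : ℕ}

/-- The linear part of an isometry of Euclidean space. -/
noncomputable def rot : (E n ≃ᵢ E n) →* (E n ≃ₗᵢ[ℝ] E n) where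
  toFun g := g.toRealLinearIsometryEquiv
  map_one' := by ext1 x; simp
  map_mul' g h := by
    ext1 x
    change _ = g.toRealLinearIsometryEquiv (h.toRealLinearIsometryEquiv x)
    rw [IsometryEquiv.toRealLinearIsometryEquiv_apply h, map_sub]
    simp [IsometryEquiv.mul_apply]

theorem rot_apply (g : E n ≃ᵢ E n) (x : E n) : rot g x = g x - g 0 :=
  g.toRealLinearIsometryEquiv_apply x

theorem apply_eq_rot (g : E n ≃ᵢ E n) (x : E n) : g x = rot g x + g 0 := by
  rw [rot_apply, sub_add_cancel]

theorem rot_mul_apply (g h : E n ≃ᵢ E n) (x : E n) : rot (g * h) x = rot g (rot h x) := by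
  rw [map_mul]; rfl

theorem rot_inv_apply_self (g : E n ≃ᵢ E n) (x : E n) : rot g⁻¹ (rot g x) = x := by
  rw [← rot_mul_apply]; simp

theorem rot_apply_inv_self (g : E n ≃ᵢ E n) (x : E n) : rot g (rot g⁻¹ x) = x := by
  rw [← rot_mul_apply]; simp

theorem apply_sub_apply (g : E n ≃ᵢ E n) (x y : E n) : g x - g y = rot g (x - y) := by
  rw [apply_eq_rot g x, apply_eq_rot g y, map_sub]; abel

/-- Translation by a vector. -/
noncomputable def translation (v : E n) : E n ≃ᵢ E n := IsometryEquiv.addRight v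

@[simp] theorem translation_apply (v x : E n) : translation v x = x + v := rfl

theorem translation_add (v w : E n) : translation (v + w) = translation v * translation w := by
  ext1 x
  simp only [translation_apply, IsometryEquiv.mul_apply]
  abel

@[simp] theorem translation_zero : translation (0 : E n) = 1 := by ext1 x; simp

theorem translation_neg (v : E n) : translation (-v) = (translation v)⁻¹ := by
  rw [eq_inv_iff_mul_eq_one, ← translation_add]; simp

theorem eq_translation_of_rot_eq_one {g : E n ≃ᵢ E n} (h : rot g = 1) :
    g = translation (g 0) := by
  ext1 x
  rw [apply_eq_rot, h]; rfl

theorem conj_translation (g : E n ≃ᵢ E n) (v : E n) :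
    g * translation v * g⁻¹ = translation (rot g v) := by
  rw [mul_inv_eq_iff_eq_mul]
  ext1 x
  simp only [IsometryEquiv.mul_apply, translation_apply]
  rw [apply_eq_rot, apply_eq_rot g x, map_add]
  abel

end Rotation

/-! ### Bieberbach's first theorem: the lattice spans and the point group is finite -/

section CommutatorArgument

variable {n : ℕ}

/-- The distance of the linear part of an isometry to the identity. -/
noncomputable def defect (g : E n ≃ᵢ E n) : ℝ :=
  ‖((rot g).toContinuousLinearEquiv : E n →L[ℝ] E n) - ContinuousLinearMap.id ℝ (E n)‖

theorem defect_nonneg (g : E n ≃ᵢ E n) : 0 ≤ defect g := norm_nonneg _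

theorem norm_rot_sub_le (g : E n ≃ᵢ E n) (x : E n) : ‖rot g x - x‖ ≤ defect g * ‖x‖ :=
  (((rot g).toContinuousLinearEquiv : E n →L[ℝ] E n) - ContinuousLinearMap.id ℝ (E n)).le_opNorm x

theorem defect_le {g : E n ≃ᵢ E n} {C : ℝ} (hC : 0 ≤ C) (h : ∀ x, ‖rot g x - x‖ ≤ C * ‖x‖) :
    defect g ≤ C :=
  ContinuousLinearMap.opNorm_le_bound _ hC h

theorem rot_eq_one_of_defect_eq_zero {g : E n ≃ᵢ E n} (h : defect g = 0) : rot g = 1 := by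
  ext1 x
  have := norm_rot_sub_le g x
  rw [h, zero_mul] at this
  exact sub_eq_zero.1 (norm_le_zero_iff.1 this)

/-- For linear parts A and B, AB - BA = (A - 1)(B - 1) - (B - 1)(A - 1), and orthogonal maps
preserve norms. -/
theorem norm_rot_commutator_sub_le (g h : E n ≃ᵢ E n) (x : E n) :
    ‖rot (g * h * g⁻¹ * h⁻¹) x - x‖ ≤ 2 * defect g * defect h * ‖x‖ := by
  obtain ⟨y, rfl⟩ : ∃ y, x = rot h (rot g y) :=
    ⟨rot g⁻¹ (rot h⁻¹ x), by rw [rot_apply_inv_self, rot_apply_inv_self]⟩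
  have e : rot (g * h * g⁻¹ * h⁻¹) (rot h (rot g y)) - rot h (rot g y)
      = (rot g (rot h y - y) - (rot h y - y)) - (rot h (rot g y - y) - (rot g y - y)) := by
    rw [rot_mul_apply, rot_mul_apply, rot_mul_apply, rot_inv_apply_self, rot_inv_apply_self,
      map_sub, map_sub]
    abel
  rw [e]
  have h1 := (norm_rot_sub_le g (rot h y - y)).trans
    (mul_le_mul_of_nonneg_left (norm_rot_sub_le h y) (defect_nonneg g))
  have h2 := (norm_rot_sub_le h (rot g y - y)).trans
    (mul_le_mul_of_nonneg_left (norm_rot_sub_le g y) (defect_nonneg h))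
  rw [LinearIsometryEquiv.norm_map, LinearIsometryEquiv.norm_map]
  refine (norm_sub_le _ _).trans ?_
  linarith

/-- The displacement of a vector under an orthogonal map does not shrink faster the second time. -/
theorem sq_norm_rot_sub_le (g : E n ≃ᵢ E n) (b : E n) :
    ‖rot g b - b‖ ^ 2 ≤ ‖b‖ * ‖rot g (rot g b - b) - (rot g b - b)‖ := by
  set D := rot g b - b with hD
  have h1 : inner ℝ (rot g b) (rot g D) = inner ℝ b D := (rot g).inner_map_map b D
  have h2 : ‖D‖ ^ 2 = - inner ℝ (rot g b) (rot g D - D) := by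
    rw [inner_sub_right, h1, neg_sub, ← inner_sub_left, ← hD, real_inner_self_eq_norm_sq]
  rw [h2]
  refine (neg_le_abs _).trans ((abs_real_inner_le_norm _ _).trans ?_)
  rw [LinearIsometryEquiv.norm_map]

/-- The orbits of a group of isometries are relatively dense. -/
def IsCocompact (Γ : Subgroup (E n ≃ᵢ E n)) : Prop :=
  ∃ d : ℝ, ∀ x, ∃ g ∈ Γ, dist (g 0) x ≤ d

theorem isCocompact_of_compactSpace {Γ : Subgroup (E n ≃ᵢ E n)}
    (h : CompactSpace (OrbitSpace Γ)) : IsCocompact Γ := by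
  obtain ⟨d, hd⟩ := (isCompact_univ (X := OrbitSpace Γ)).isBounded.subset_closedBall
    (OrbitSpace.mk Γ 0)
  refine ⟨d + 1, fun x => ?_⟩
  have h1 : dist (OrbitSpace.mk Γ x) (OrbitSpace.mk Γ 0) < d + 1 :=
    (Metric.mem_closedBall.1 (hd (Set.mem_univ _))).trans_lt (by linarith)
  obtain ⟨γ, hγ⟩ := orbitDist_lt_iff.1 h1
  exact ⟨γ, γ.2, by rw [dist_comm]; exact hγ.le⟩

/-- Choose elements carrying 0 to within `d` of each multiple `k • u`. By compactness a subsequence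
of their rotations converges, so a quotient of two late terms has small rotation. Its displacement
error stays bounded while `s` grows. -/
theorem exists_almost_translation {Γ : Subgroup (E n ≃ᵢ E n)} (hc : IsCocompact Γ)
    (u : E n) {ε δ : ℝ} (hε : 0 < ε) (hδ : 0 < δ) :
    ∃ g ∈ Γ, ∃ s : ℝ, 0 < s ∧ defect g ≤ ε ∧ ‖g 0 - s • u‖ ≤ δ * s := by
  obtain ⟨d, hd⟩ := hc
  choose! f hfΓ hf using fun k : ℕ => hd ((k : ℝ) • u)
  let R : ℕ → (E n →L[ℝ] E n) := fun k => ((rot (f k)).toContinuousLinearEquiv : E n →L[ℝ] E n)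
  have hR : ∀ k, R k ∈ Metric.closedBall (0 : E n →L[ℝ] E n) 1 := fun k => by
    rw [mem_closedBall_zero_iff]
    refine ContinuousLinearMap.opNorm_le_bound _ zero_le_one fun x => ?_
    rw [one_mul]
    exact ((rot (f k)).norm_map x).le
  obtain ⟨a, -, φ, hφ, ha⟩ := tendsto_subseq_of_bounded Metric.isBounded_closedBall hR
  obtain ⟨N, hN⟩ := Metric.cauchySeq_iff.1 ha.cauchySeq ε hε
  obtain ⟨K, hK⟩ := exists_nat_ge ((dist (f (φ N) 0) 0 + d) / δ)
  set j := max (max N K) 1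
  have hjN : N ≤ j := (le_max_left _ _).trans (le_max_left _ _)
  have hjK : K ≤ j := (le_max_right _ _).trans (le_max_left _ _)
  have hj1 : 1 ≤ j := le_max_right _ _
  have hjφ : j ≤ φ j := hφ.le_apply
  refine ⟨f (φ j) * (f (φ N))⁻¹, Γ.mul_mem (hfΓ _) (Γ.inv_mem (hfΓ _)), (φ j : ℝ), ?_, ?_, ?_⟩
  · exact_mod_cast lt_of_lt_of_le (by lia) hjφ
  · refine defect_le hε.le fun x => ?_
    obtain ⟨y, rfl⟩ : ∃ y, x = rot (f (φ N)) y := ⟨rot (f (φ N))⁻¹ x, by rw [rot_apply_inv_self]⟩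
    rw [rot_mul_apply, rot_inv_apply_self, LinearIsometryEquiv.norm_map]
    have h1 : ‖R (φ j) - R (φ N)‖ < ε := by
      rw [← dist_eq_norm]; exact hN j hjN N le_rfl
    exact ((R (φ j) - R (φ N)).le_opNorm y).trans
      (mul_le_mul_of_nonneg_right h1.le (norm_nonneg y))
  · have h1 : dist ((f (φ j) * (f (φ N))⁻¹) 0) (f (φ j) 0) = dist (f (φ N) 0) 0 := by
      rw [IsometryEquiv.mul_apply, (f (φ j)).dist_eq, ← (f (φ N)).dist_eq,
        IsometryEquiv.apply_inv_self, dist_comm]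
    rw [← dist_eq_norm]
    refine (dist_triangle _ (f (φ j) 0) _).trans ?_
    rw [h1]
    refine (add_le_add_right (hf (φ j)) _).trans ?_
    rw [div_le_iff₀ hδ] at hK
    refine hK.trans ?_
    rw [mul_comm]
    exact mul_le_mul_of_nonneg_left (by exact_mod_cast hjK.trans hjφ) hδ.le

/-- The first term is the displacement of `h 0` by the rotation of `g`; the bracketed terms are
errors controlled by the defect of `h`. -/
theorem commutator_apply_zero (g h : E n ≃ᵢ E n) :
    (g * h * g⁻¹ * h⁻¹) 0 = (rot g (h 0) - h 0)
      + ((h 0 - rot (g * h * g⁻¹ * h⁻¹) (h 0)) + (g 0 - rot (g * h * g⁻¹) (g 0))) := by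
  have e1 : (g * h * g⁻¹ * h⁻¹) (h (g 0)) = g (h 0) := by
    simp [IsometryEquiv.mul_apply]
  have e2 : rot (g * h * g⁻¹ * h⁻¹) (h (g 0))
      = rot (g * h * g⁻¹ * h⁻¹) (h 0) + rot (g * h * g⁻¹) (g 0) := by
    rw [apply_eq_rot h (g 0), map_add, add_comm, rot_mul_apply _ h⁻¹ (rot h _), rot_inv_apply_self]
  rw [apply_eq_rot _ (h (g 0)), e2, apply_eq_rot g (h 0)] at e1
  rw [eq_sub_of_add_eq' e1]; abel

/-- If some small rotation `a` were nontrivial, commutators with `a` would shorten elements `b`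
indefinitely. The elements kept are those whose translation vector is moved by `a` in a definite
proportion, with a margin `K * defect b`; this condition survives passing to the commutator. -/
theorem rot_eq_one_of_defect_le {Γ : Subgroup (E n ≃ᵢ E n)} (hd : IsProperlyDiscontinuous Γ)
    (hc : IsCocompact Γ) {g : E n ≃ᵢ E n} (hg : g ∈ Γ) (hg4 : defect g ≤ 1 / 4) : rot g = 1 := by
  by_contra hne
  obtain ⟨a, ⟨haΓ, ha0, ha4⟩, hamin⟩ := hd.exists_isMin 0 0
    (S := {a | a ∈ Γ ∧ 0 < defect a ∧ defect a ≤ 1 / 4}) (fun a ha => ha.1)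
    ⟨g, hg, (defect_nonneg g).lt_of_ne fun h => hne (rot_eq_one_of_defect_eq_zero h.symm), hg4⟩
  obtain ⟨u, hu⟩ : ∃ u, rot a u - u ≠ 0 := by
    by_contra! hcon
    exact ha0.ne' (le_antisymm (defect_le le_rfl fun x => by simp [hcon x]) (defect_nonneg a))
  have hu0 : 0 < ‖u‖ := norm_pos_iff.2 fun h => hu (by simp [h])
  set w := ‖rot a u - u‖ with hw
  have hw0 : 0 < w := norm_pos_iff.2 hu
  -- The factor 4 leaves room to approximate the direction `u` by a group element. The choice `K * c
  -- = 3 / 2` makes the margin gained when the defect halves exactly cover the error terms below.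
  set c := w / (4 * ‖u‖) with hcdef
  have hc0 : 0 < c := by positivity
  have hcu : c * ‖u‖ = w / 4 := by rw [hcdef]; field_simp
  set K := 3 / (2 * c) with hKdef
  have hK0 : 0 < K := by positivity
  have hKc : K * c = 3 / 2 := by rw [hKdef]; field_simp
  obtain ⟨b, ⟨hbΓ, hb0, hb4, hbc⟩, hbmin⟩ := hd.exists_isMin 0 0
    (S := {b | b ∈ Γ ∧ b 0 ≠ 0 ∧ defect b ≤ 1 / 4 ∧
      (c + K * defect b) * ‖b 0‖ ≤ ‖rot a (b 0) - b 0‖}) (fun a ha => ha.1) (by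
    obtain ⟨b, hb, s, hs, hbd, hbs⟩ := exists_almost_translation hc u
      (ε := min (1 / 4) (c / K)) (δ := min (‖u‖ / 4) (w / 4)) (by positivity) (by positivity)
    have hδ1 : ‖b 0 - s • u‖ ≤ ‖u‖ / 4 * s :=
      hbs.trans (mul_le_mul_of_nonneg_right (min_le_left _ _) hs.le)
    have hδ2 : ‖b 0 - s • u‖ ≤ w / 4 * s :=
      hbs.trans (mul_le_mul_of_nonneg_right (min_le_right _ _) hs.le)
    have hsu : ‖s • u‖ = s * ‖u‖ := by rw [norm_smul, Real.norm_of_nonneg hs.le]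
    have hup : ‖b 0‖ ≤ 5 / 4 * (s * ‖u‖) := by
      have := norm_le_norm_add_norm_sub' (b 0) (s • u)
      rw [hsu] at this; linarith
    have hlow : 3 / 4 * (s * w) ≤ ‖rot a (b 0) - b 0‖ := by
      have e : s • (rot a u - u) = (rot a (b 0) - b 0)
          - (rot a (b 0 - s • u) - (b 0 - s • u)) := by
        rw [map_sub, map_smul, smul_sub]; abel
      have h1 : s * w = ‖s • (rot a u - u)‖ := by rw [norm_smul, Real.norm_of_nonneg hs.le]
      have h2 := norm_rot_sub_le a (b 0 - s • u)
      have h3 := mul_le_mul ha4 hδ2 (norm_nonneg _) (by norm_num)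
      rw [e] at h1
      have h4 := norm_sub_le (rot a (b 0) - b 0) (rot a (b 0 - s • u) - (b 0 - s • u))
      have : 0 ≤ s * w := by positivity
      linarith
    refine ⟨b, hb, ?_, hbd.trans (min_le_left _ _), ?_⟩
    · intro h0
      rw [h0] at hlow
      simp only [map_zero, sub_zero, norm_zero] at hlow
      have : 0 < s * w := by positivity
      linarith
    · have h1 : K * defect b ≤ c := by
        have := hbd.trans (min_le_right _ _)
        rw [le_div_iff₀ hK0] at this; linarith
      calc (c + K * defect b) * ‖b 0‖ ≤ (2 * c) * (5 / 4 * (s * ‖u‖)) := by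
            refine mul_le_mul (by linarith) hup (norm_nonneg _) (by positivity)
        _ = 5 / 2 * s * (c * ‖u‖) := by ring
        _ ≤ 3 / 4 * (s * w) := by
          rw [hcu]
          have : 0 < s * w := by positivity
          linarith
        _ ≤ _ := hlow)
  set μ := defect b with hμ
  have hμ0 : 0 ≤ μ := defect_nonneg b
  set B := ‖b 0‖ with hB
  have hB0 : 0 < B := norm_pos_iff.2 hb0
  set x := rot a (b 0) - b 0 with hx
  set F := ‖x‖ with hF
  set b' := a * b * a⁻¹ * b⁻¹ with hb'
  set e := (b 0 - rot b' (b 0)) + (a 0 - rot (a * b * a⁻¹) (a 0)) with he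
  have hb'0 : b' 0 = x + e := commutator_apply_zero a b
  have hF4 : F ≤ B / 4 := (norm_rot_sub_le a (b 0)).trans (by
    have := mul_le_mul_of_nonneg_right ha4 hB0.le
    linarith)
  -- Minimality of `a` bounds its translation part only against elements with nontrivial rotation;
  -- when `μ = 0` the product vanishes anyway.
  have hμa : μ * ‖a 0‖ ≤ μ * B := by
    rcases hμ0.eq_or_lt with h0 | h0
    · rw [← h0, zero_mul, zero_mul]
    · have := hamin b ⟨hbΓ, h0, hb4⟩
      rw [dist_zero_right, dist_zero_right] at this
      exact mul_le_mul_of_nonneg_left this hμ0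
  have hcomm : ∀ y, ‖rot b' y - y‖ ≤ μ / 2 * ‖y‖ := fun y => by
    refine (norm_rot_commutator_sub_le a b y).trans (mul_le_mul_of_nonneg_right ?_ (norm_nonneg y))
    have := mul_le_mul_of_nonneg_right ha4 hμ0
    linarith
  have he1 : ‖e‖ ≤ 3 / 2 * μ * B := by
    have h1 : ‖b 0 - rot b' (b 0)‖ ≤ μ / 2 * B := by rw [norm_sub_rev]; exact hcomm _
    have h2 : ‖a 0 - rot (a * b * a⁻¹) (a 0)‖ ≤ μ * ‖a 0‖ := by
      obtain ⟨y, hy⟩ : ∃ y, a 0 = rot a y := ⟨rot a⁻¹ (a 0), by rw [rot_apply_inv_self]⟩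
      rw [hy, rot_mul_apply, rot_inv_apply_self, rot_mul_apply, ← map_sub,
        LinearIsometryEquiv.norm_map, LinearIsometryEquiv.norm_map, norm_sub_rev]
      exact norm_rot_sub_le b y
    have := norm_add_le (b 0 - rot b' (b 0)) (a 0 - rot (a * b * a⁻¹) (a 0))
    linarith
  have hb'μ : defect b' ≤ μ / 2 := defect_le (by positivity) hcomm
  have hμB : 0 ≤ μ * B := by positivity
  have hμB4 : μ * B ≤ 1 / 4 * B := mul_le_mul_of_nonneg_right hb4 hB0.le
  have hup : ‖b' 0‖ ≤ F + 3 / 2 * μ * B := by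
    rw [hb'0]; exact (norm_add_le _ _).trans (by linarith)
  have hF0 : 0 < F := lt_of_lt_of_le (by positivity) hbc
  have hDx : F ^ 2 ≤ B * ‖rot a x - x‖ := sq_norm_rot_sub_le a (b 0)
  have hDe : ‖rot a e - e‖ ≤ 3 / 8 * μ * B := (norm_rot_sub_le a e).trans (by
    have := mul_le_mul ha4 he1 (norm_nonneg _) (by norm_num)
    linarith)
  have hlow : ‖rot a x - x‖ - 3 / 8 * μ * B ≤ ‖rot a (b' 0) - b' 0‖ := by
    have e2 : rot a x - x = (rot a (b' 0) - b' 0) - (rot a e - e) := by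
      rw [hb'0, map_add]; abel
    have := norm_sub_le (rot a (b' 0) - b' 0) (rot a e - e)
    rw [← e2] at this
    linarith
  -- By `hDx`, the vector `x` is displaced by `a` in proportion at least `F / B`, hence at least `c
  -- + K * μ`. Replacing `μ` by `μ / 2` frees at least `3 / 4 * μ * B ^ 2`, which pays for two
  -- errors of `3 / 8 * μ * B ^ 2`.
  have hcone : (c + K * (μ / 2)) * (F + 3 / 2 * μ * B) + 3 / 8 * μ * B ≤ ‖rot a x - x‖ := by
    have h1 : B * ((c + K * (μ / 2)) * (F + 3 / 2 * μ * B) + 3 / 8 * μ * B) ≤ F ^ 2 := by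
      have hcF : c * B ≤ F := le_trans
        (mul_le_mul_of_nonneg_right (by linarith [mul_nonneg hK0.le hμ0]) hB0.le) hbc
      have hKB : K * F ≥ 3 / 2 * B := by
        have := mul_le_mul_of_nonneg_left hcF hK0.le
        rw [← mul_assoc, hKc] at this; exact this
      have s1 : (c + K * μ) * B * F ≤ F * F := mul_le_mul_of_nonneg_right hbc hF0.le
      have s2 : (c + K * (μ / 2)) * B ≤ F := le_trans
        (mul_le_mul_of_nonneg_right (by linarith [mul_nonneg hK0.le hμ0]) hB0.le) hbc
      have s3 : (c + K * (μ / 2)) * B * (3 / 2 * μ * B) ≤ F * (3 / 2 * μ * B) :=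
        mul_le_mul_of_nonneg_right s2 (by positivity)
      have s4 : F * (μ * B) ≤ B / 4 * (μ * B) := mul_le_mul_of_nonneg_right hF4 hμB
      have s5 : μ * B * (3 / 2 * B) ≤ μ * B * (K * F) := mul_le_mul_of_nonneg_left hKB hμB
      nlinarith
    exact le_of_mul_le_mul_left (h1.trans hDx) hB0
  have hfin : (c + K * defect b') * ‖b' 0‖ ≤ ‖rot a (b' 0) - b' 0‖ := by
    have h1 : (c + K * defect b') * ‖b' 0‖ ≤ (c + K * (μ / 2)) * (F + 3 / 2 * μ * B) := by
      refine mul_le_mul ?_ hup (norm_nonneg _) (by positivity)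
      have := mul_le_mul_of_nonneg_left hb'μ hK0.le
      linarith
    linarith
  have hb'ne : b' 0 ≠ 0 := by
    intro h0
    rw [h0] at hlow
    simp only [map_zero, sub_zero, norm_zero] at hlow
    have : 0 < (c + K * (μ / 2)) * (F + 3 / 2 * μ * B) := by positivity
    linarith
  -- The commutator is again admissible, yet `‖b' 0‖ ≤ B / 4 + 3 / 8 * B < B`.
  have := hbmin b' ⟨Γ.mul_mem (Γ.mul_mem (Γ.mul_mem haΓ hbΓ) (Γ.inv_mem haΓ)) (Γ.inv_mem hbΓ),
    hb'ne, hb'μ.trans (by linarith), hfin⟩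
  rw [dist_zero_right, dist_zero_right] at this
  change B ≤ ‖b' 0‖ at this
  linarith

/-- The translation vectors of a group of isometries. -/
def translationLattice (Γ : Subgroup (E n ≃ᵢ E n)) : Submodule ℤ (E n) :=
  AddSubgroup.toIntSubmodule
    { carrier := {v | translation v ∈ Γ}
      zero_mem' := by simp [Γ.one_mem]
      add_mem' := fun {v w} hv hw => by
        rw [Set.mem_ofPred_eq, translation_add]; exact Γ.mul_mem hv hw
      neg_mem' := fun {v} hv => by
        rw [Set.mem_ofPred_eq, translation_neg]; exact Γ.inv_mem hv }

theorem mem_translationLattice {Γ : Subgroup (E n ≃ᵢ E n)} {v : E n} :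
    v ∈ translationLattice Γ ↔ translation v ∈ Γ := Iff.rfl

theorem rot_mem_translationLattice {Γ : Subgroup (E n ≃ᵢ E n)} {g : E n ≃ᵢ E n} (hg : g ∈ Γ)
    {v : E n} (hv : v ∈ translationLattice Γ) : rot g v ∈ translationLattice Γ := by
  rw [mem_translationLattice, ← conj_translation]
  exact Γ.mul_mem (Γ.mul_mem hg hv) (Γ.inv_mem hg)

theorem discreteTopology_translationLattice {Γ : Subgroup (E n ≃ᵢ E n)}
    (hd : IsProperlyDiscontinuous Γ) : DiscreteTopology (translationLattice Γ) := by
  obtain ⟨r, hr, hfix⟩ := hd.exists_fix_radius (0 : E n)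
  rw [discreteTopology_iff_isOpen_singleton_zero, Metric.isOpen_singleton_iff]
  refine ⟨r, hr, fun v hv => ?_⟩
  have := hfix (translation v) v.2 (by simpa using hv)
  exact Subtype.ext (by simpa using this)

/-- An almost translation in a direction orthogonal to the span would be a genuine translation, with
vector in the span but too close to that orthogonal direction. -/
theorem span_translationLattice {Γ : Subgroup (E n ≃ᵢ E n)} (hd : IsProperlyDiscontinuous Γ)
    (hc : IsCocompact Γ) : Submodule.span ℝ (translationLattice Γ : Set (E n)) = ⊤ := by
  by_contra hne
  set W := Submodule.span ℝ (translationLattice Γ : Set (E n))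
  have : Wᗮ ≠ ⊥ := fun h => hne ((Submodule.orthogonal_eq_bot_iff).1 h)
  obtain ⟨u, hu, hu0⟩ := Submodule.exists_mem_ne_zero_of_ne_bot this
  have hun : 0 < ‖u‖ := norm_pos_iff.2 hu0
  obtain ⟨g, hg, s, hs, hgd, hgs⟩ := exists_almost_translation hc u (ε := 1 / 4) (δ := ‖u‖ / 2)
    (by norm_num) (by positivity)
  have hg1 := rot_eq_one_of_defect_le hd hc hg hgd
  have hmem : g 0 ∈ W := Submodule.subset_span (by
    change translation (g 0) ∈ Γ
    rwa [← eq_translation_of_rot_eq_one hg1])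
  have horth : inner ℝ (g 0) (s • u) = 0 := by
    rw [inner_smul_right, (Submodule.mem_orthogonal _ _).1 hu _ hmem, mul_zero]
  have hpy := norm_sub_sq_real (g 0) (s • u)
  rw [horth, norm_smul, Real.norm_of_nonneg hs.le] at hpy
  have h1 : ‖g 0 - s • u‖ ^ 2 ≤ (‖u‖ / 2 * s) ^ 2 := by gcongr
  have h2 : 0 < (s * ‖u‖) ^ 2 := by positivity
  nlinarith [sq_nonneg ‖g 0‖]

/-- Distinct rotations are at least 1/4 apart in operator norm, since otherwise a quotient would
have small nontrivial rotation; orthogonal maps form a bounded set. -/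
theorem finite_image_rot {Γ : Subgroup (E n ≃ᵢ E n)} (hd : IsProperlyDiscontinuous Γ)
    (hc : IsCocompact Γ) : (rot '' (Γ : Set (E n ≃ᵢ E n))).Finite := by
  let R : (E n ≃ₗᵢ[ℝ] E n) → (E n →L[ℝ] E n) := fun A => (A.toContinuousLinearEquiv : E n →L[ℝ] E n)
  have hR : Function.Injective R := fun A B h => by
    ext1 x; exact DFunLike.congr_fun h x
  refine Set.Finite.of_finite_image (f := R) ?_ hR.injOn
  refine finite_of_isBounded_of_separated (ε := 1 / 4) ?_ (by norm_num) ?_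
  · refine Metric.isBounded_closedBall (x := 0) (r := 1) |>.subset ?_
    rintro _ ⟨A, -, rfl⟩
    rw [mem_closedBall_zero_iff]
    refine ContinuousLinearMap.opNorm_le_bound _ zero_le_one fun x => ?_
    rw [one_mul]
    exact (A.norm_map x).le
  · rintro _ ⟨_, ⟨g, hg, rfl⟩, rfl⟩ _ ⟨_, ⟨h, hh, rfl⟩, rfl⟩ hlt
    have : rot (g * h⁻¹) = 1 := by
      refine rot_eq_one_of_defect_le hd hc (Γ.mul_mem hg (Γ.inv_mem hh))
        (defect_le (by norm_num) fun x => ?_)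
      obtain ⟨y, rfl⟩ : ∃ y, x = rot h y := ⟨rot h⁻¹ x, by rw [rot_apply_inv_self]⟩
      rw [rot_mul_apply, rot_inv_apply_self, LinearIsometryEquiv.norm_map]
      rw [dist_eq_norm] at hlt
      exact ((R (rot g) - R (rot h)).le_opNorm y).trans
        (mul_le_mul_of_nonneg_right hlt.le (norm_nonneg y))
    rw [map_mul, map_inv, mul_inv_eq_one] at this
    rw [this]

end CommutatorArgument

/-! ### Affine rigidity, fixed sets and extension of local isometries -/

section Affine

variable {n : ℕ}

theorem affineMap_eq_of_eventuallyEq {f g : E n →ᵃ[ℝ] E n} {p : E n}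
    (h : ∀ᶠ x in 𝓝 p, f x = g x) : f = g := by
  ext1 x
  have hlim : Filter.Tendsto (fun t : ℝ => AffineMap.lineMap p x t) (𝓝[≠] 0) (𝓝 p) := by
    have : Filter.Tendsto (fun t : ℝ => AffineMap.lineMap p x t) (𝓝 0)
        (𝓝 (AffineMap.lineMap p x (0 : ℝ))) :=
      (AffineMap.lineMap_continuous (p := p) (q := x)).tendsto 0
    rw [AffineMap.lineMap_apply_zero] at this
    exact this.mono_left nhdsWithin_le_nhds
  obtain ⟨t, ht, ht0⟩ := ((hlim.eventually h).and self_mem_nhdsWithin).exists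
  rw [AffineMap.apply_lineMap, AffineMap.apply_lineMap, ← h.self_of_nhds,
    AffineMap.lineMap_apply, AffineMap.lineMap_apply] at ht
  simp only [vsub_eq_sub, vadd_eq_add, add_left_inj] at ht
  exact sub_left_injective (smul_right_injective _ ht0 ht)

/-- An isometry of Euclidean space as an affine map. -/
noncomputable def affine (g : E n ≃ᵢ E n) : E n ≃ᵃ[ℝ] E n :=
  g.toRealAffineIsometryEquiv.toAffineEquiv

@[simp] theorem affine_apply (g : E n ≃ᵢ E n) (x : E n) : affine g x = g x :=
  congrFun g.coeFn_toRealAffineIsometryEquiv x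

theorem isOpen_setOf_apply_ne (g : E n ≃ᵢ E n) : IsOpen {x | g x ≠ x} :=
  isOpen_ne_fun g.continuous continuous_id

theorem dense_setOf_apply_ne {g : E n ≃ᵢ E n} (hg : g ≠ 1) : Dense {x | g x ≠ x} := by
  have : {x | g x ≠ x} = {x | g x = x}ᶜ := rfl
  rw [this, ← interior_eq_empty_iff_dense_compl, Set.eq_empty_iff_forall_notMem]
  intro p hp
  apply hg
  have h := affineMap_eq_of_eventuallyEq (f := (affine g : E n →ᵃ[ℝ] E n))
    (g := AffineMap.id ℝ (E n)) (p := p) (by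
      filter_upwards [mem_interior_iff_mem_nhds.1 hp] with x hx
      simpa using hx)
  ext1 x
  simpa using DFunLike.congr_fun h x

/-- The cone from `p` over the common fixed set spans a proper subspace: otherwise that set is a
hyperplane missing `p`, and `a` and `b` are both the reflection in it. Thus generic lines from `p`
avoid common fixed points. -/
theorem exists_submodule_of_fixed {a b : E n ≃ᵢ E n} (hab : a ≠ b) {p : E n} (hap : a p ≠ p)
    (hbp : b p ≠ p) : ∃ W : Submodule ℝ (E n), W ≠ ⊤ ∧ ∀ (q : E n) (t : ℝ), t ≠ 0 →
      a (AffineMap.lineMap p q t) = AffineMap.lineMap p q t →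
      b (AffineMap.lineMap p q t) = AffineMap.lineMap p q t → q - p ∈ W := by
  by_cases hM : ∃ c, a c = c ∧ b c = c
  swap
  · refine ⟨⊥, fun h => ?_, fun q t _ ha hb => absurd ⟨_, ha, hb⟩ hM⟩
    have : Subsingleton (E n) := by
      rwa [← Submodule.subsingleton_iff ℝ, ← subsingleton_iff_bot_eq_top]
    exact hap (Subsingleton.elim _ _)
  obtain ⟨c, hac, hbc⟩ := hM
  have hA : ∀ x, a x = c + rot a (x - c) := fun x => by
    rw [← apply_sub_apply, hac]; abel
  have hB : ∀ x, b x = c + rot b (x - c) := fun x => by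
    rw [← apply_sub_apply, hbc]; abel
  let V : Submodule ℝ (E n) :=
    { carrier := {v | rot a v = v ∧ rot b v = v}
      zero_mem' := by simp
      add_mem' := fun {v w} hv hw => by
        refine ⟨?_, ?_⟩
        · rw [map_add, hv.1, hw.1]
        · rw [map_add, hv.2, hw.2]
      smul_mem' := fun s v hv => by
        refine ⟨?_, ?_⟩
        · rw [map_smul, hv.1]
        · rw [map_smul, hv.2] }
  refine ⟨V ⊔ ℝ ∙ (p - c), fun htop => hab ?_, fun q t ht ha hb => ?_⟩
  · have hall : ∀ z, ∃ m ∈ V, ∃ s : ℝ, z = m + s • (p - c) := fun z => by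
      have : z ∈ V ⊔ ℝ ∙ (p - c) := by rw [htop]; trivial
      obtain ⟨m, hm, y, hy, rfl⟩ := Submodule.mem_sup.1 this
      obtain ⟨s, rfl⟩ := Submodule.mem_span_singleton.1 hy
      exact ⟨m, hm, s, rfl⟩
    obtain ⟨v, hv, w, hw, hvw⟩ := V.exists_add_mem_mem_orthogonal (p - c)
    have hw0 : w ≠ 0 := by
      rintro rfl
      apply hap
      rw [hA, hvw, add_zero, hv.1, ← add_zero v, ← hvw]; abel
    have hperp : ∀ z ∈ Vᗮ, ∃ s : ℝ, z = s • w := fun z hz => by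
      obtain ⟨m, hm, s, hs⟩ := hall z
      refine ⟨s, ?_⟩
      have h1 : z - s • w ∈ V := by
        rw [hs, hvw, smul_add]
        have : m + (s • v + s • w) - s • w = m + s • v := by abel
        rw [this]
        exact V.add_mem hm (V.smul_mem s hv)
      have h2 : z - s • w ∈ Vᗮ := Submodule.sub_mem _ hz (Submodule.smul_mem _ s hw)
      exact sub_eq_zero.1 (inner_self_eq_zero.1 (((Submodule.mem_orthogonal V _).1 h2) _ h1))
    -- The orthogonal complement of `V` is the line of `w`, so an orthogonal map fixing `V` acts
    -- there by a sign; the sign + would fix `p - c`.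
    have hneg : ∀ A : E n ≃ₗᵢ[ℝ] E n, (∀ v ∈ V, A v = v) → A (p - c) ≠ p - c → A w = -w := by
      intro A hAV hAp
      have hAw : A w ∈ Vᗮ := (Submodule.mem_orthogonal V _).2 fun m hm => by
        rw [← hAV m hm, A.inner_map_map]
        exact (Submodule.mem_orthogonal V _).1 hw m hm
      obtain ⟨s, hs⟩ := hperp _ hAw
      have h1 : |s| * ‖w‖ = ‖w‖ := by
        rw [← Real.norm_eq_abs, ← norm_smul, ← hs, A.norm_map]
      have h2 : |s| = 1 := by
        rwa [mul_eq_right₀ (norm_ne_zero_iff.2 hw0)] at h1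
      rcases eq_or_eq_neg_of_abs_eq h2 with rfl | rfl
      · exfalso
        apply hAp
        rw [hvw, map_add, hAV v hv, hs, one_smul]
      · rw [hs, neg_one_smul]
    have ha' : rot a w = -w := hneg (rot a) (fun v hv => hv.1) fun h => hap (by
      rw [hA, h]; abel)
    have hb' : rot b w = -w := hneg (rot b) (fun v hv => hv.2) fun h => hbp (by
      rw [hB, h]; abel)
    ext1 x
    obtain ⟨m, hm, s, hs⟩ := hall (x - c)
    rw [hA, hB, hs, hvw, map_add, map_add, map_smul, map_smul, map_add, map_add, ha', hb',
      hm.1, hm.2, hv.1, hv.2]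
  · set m := (AffineMap.lineMap p q t : E n) with hm
    have hmV : m - c ∈ V := by
      refine ⟨?_, ?_⟩
      · rw [← apply_sub_apply, ha, hac]
      · rw [← apply_sub_apply, hb, hbc]
    have h1 : t • (q - p) = (m - c) - (p - c) := by
      rw [hm, AffineMap.lineMap_apply]; simp
    rw [← Submodule.smul_mem_iff _ ht, h1]
    exact Submodule.sub_mem _ (Submodule.mem_sup_left hmV)
      (Submodule.mem_sup_right (Submodule.mem_span_singleton_self _))

/-- Polarization preserves inner products based at `p`, so the rescaled images of an orthonormal
frame determine `h` on the ball. -/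
theorem exists_isometry_eqOn_ball {h : E n → E n} {p : E n} {r : ℝ} (hr : 0 < r)
    (hh : ∀ x ∈ Metric.ball p r, ∀ y ∈ Metric.ball p r, dist (h x) (h y) = dist x y) :
    ∃ g : E n ≃ᵢ E n, ∀ x ∈ Metric.ball p r, g x = h x := by
  have hp : p ∈ Metric.ball p r := Metric.mem_ball_self hr
  have hinner : ∀ x ∈ Metric.ball p r, ∀ y ∈ Metric.ball p r,
      inner ℝ (h x - h p) (h y - h p) = inner ℝ (x - p) (y - p) := by
    intro x hx y hy
    rw [real_inner_eq_norm_mul_self_add_norm_mul_self_sub_norm_sub_mul_self_div_two,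
      real_inner_eq_norm_mul_self_add_norm_mul_self_sub_norm_sub_mul_self_div_two]
    simp only [sub_sub_sub_cancel_right, ← dist_eq_norm]
    rw [hh x hx p hp, hh y hy p hp, hh x hx y hy]
  set e := EuclideanSpace.basisFun (Fin n) ℝ
  set ρ := r / 2 with hρ
  have hρ0 : ρ ≠ 0 := by positivity
  have hmem : ∀ i, p + ρ • e i ∈ Metric.ball p r := fun i => by
    rw [Metric.mem_ball, dist_eq_norm, add_sub_cancel_left, norm_smul, e.orthonormal.1 i,
      Real.norm_of_nonneg (by positivity)]
    linarith
  let u : Fin n → E n := fun i => ρ⁻¹ • (h (p + ρ • e i) - h p)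
  have hux : ∀ i, ∀ x ∈ Metric.ball p r, inner ℝ (u i) (h x - h p) = inner ℝ (e i) (x - p) := by
    intro i x hx
    rw [real_inner_smul_left, hinner _ (hmem i) x hx, add_sub_cancel_left, real_inner_smul_left,
      inv_mul_cancel_left₀ hρ0]
  have hu : Orthonormal ℝ u := by
    rw [orthonormal_iff_ite]
    intro i j
    change inner ℝ (u i) (ρ⁻¹ • (h (p + ρ • e j) - h p)) = _
    rw [real_inner_smul_right, hux i _ (hmem j), add_sub_cancel_left, real_inner_smul_right,
      inv_mul_cancel_left₀ hρ0]
    exact orthonormal_iff_ite.1 e.orthonormal i j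
  have hcard : Fintype.card (Fin n) = Module.finrank ℝ (E n) := by simp
  let U : OrthonormalBasis (Fin n) ℝ (E n) :=
    OrthonormalBasis.mk hu (hu.linearIndependent.span_eq_top_of_card_eq_finrank' hcard).ge
  have hU : ∀ i, U i = u i := fun i => by simp [U]
  let A : E n ≃ₗᵢ[ℝ] E n := e.equiv U (Equiv.refl _)
  have hA : ∀ i, A (e i) = u i := fun i => by
    rw [← hU]; simp [A]
  refine ⟨translation (h p) * A.toIsometryEquiv * translation (-p), fun x hx => ?_⟩
  have : A (x - p) = h x - h p := by
    refine U.repr.injective ?_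
    ext i
    rw [U.repr_apply_apply, U.repr_apply_apply, hU, hux i x hx, ← hA, A.inner_map_map]
  simp only [IsometryEquiv.mul_apply, translation_apply, LinearIsometryEquiv.coe_toIsometryEquiv]
  rw [← sub_eq_add_neg, this, sub_add_cancel]

end Affine

/-! ### Lifting isometries of the orbit space -/

section Lifting

variable {n : ℕ}

theorem exists_mem_forall_apply_ne {S : Set (E n ≃ᵢ E n)} (hS : S.Countable) (h1 : 1 ∉ S)
    {U : Set (E n)} (hU : IsOpen U) (hne : U.Nonempty) : ∃ x ∈ U, ∀ g ∈ S, g x ≠ x := by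
  have hd : Dense (⋂ g ∈ S, {x | g x ≠ x}) :=
    dense_biInter_of_isOpen (fun g _ => isOpen_setOf_apply_ne g) hS
      fun g hg => dense_setOf_apply_ne fun h => h1 (h ▸ hg)
  obtain ⟨x, hx, hxU⟩ := hd.inter_open_nonempty U hU hne |>.imp fun _ h => h.symm
  exact ⟨x, hxU, fun g hg => Set.mem_iInter₂.1 hx g hg⟩

/-- A map behaving like the quotient map by a properly discontinuous group of isometries. -/
structure IsOrbitMap {Q : Type*} [PseudoMetricSpace Q] (Γ : Subgroup (E n ≃ᵢ E n))
    (π : E n → Q) : Prop where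
  surjective : Function.Surjective π
  dist_le : ∀ g ∈ Γ, ∀ x y, dist (π x) (π y) ≤ dist (g x) y
  exists_dist_eq : ∀ x y, ∃ g ∈ Γ, dist (π x) (π y) = dist (g x) y

theorem isOrbitMap_mk {Γ : Subgroup (E n ≃ᵢ E n)} (h : IsProperlyDiscontinuous Γ) :
    IsOrbitMap Γ (OrbitSpace.mk Γ) where
  surjective := OrbitSpace.mk_surjective
  dist_le _ hg x y := dist_mk_le x y hg
  exists_dist_eq := h.exists_dist_eq

namespace IsOrbitMap

variable {Q : Type*} [PseudoMetricSpace Q] {Γ Λ : Subgroup (E n ≃ᵢ E n)} {π ρ : E n → Q}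

theorem dist_apply_self (h : IsOrbitMap Γ π) {g : E n ≃ᵢ E n} (hg : g ∈ Γ) (x : E n) :
    dist (π x) (π (g x)) = 0 :=
  le_antisymm ((h.dist_le g hg x (g x)).trans (dist_self _).le) dist_nonneg

theorem dist_le_dist (h : IsOrbitMap Γ π) (x y : E n) : dist (π x) (π y) ≤ dist x y :=
  h.dist_le 1 Γ.one_mem x y

theorem continuous (h : IsOrbitMap Γ π) : Continuous π :=
  (LipschitzWith.of_dist_le' (K := 1) fun x y => by
    rw [one_mul]; exact h.dist_le_dist x y).continuous

/-- The set of points at which two orbit maps agree. -/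
def coincidence (π ρ : E n → Q) : Set (E n) := {x | dist (π x) (ρ x) = 0}

theorem coincidence_comm (π ρ : E n → Q) : coincidence π ρ = coincidence ρ π := by
  ext x; simp only [coincidence, dist_comm]

theorem isClosed_coincidence (hπ : IsOrbitMap Γ π) (hρ : IsOrbitMap Λ ρ) :
    IsClosed (coincidence π ρ) :=
  isClosed_eq (hπ.continuous.dist hρ.continuous) continuous_const

theorem apply_mem_coincidence_iff (hπ : IsOrbitMap Γ π) (hρ : IsOrbitMap Λ ρ) {g : E n ≃ᵢ E n}
    (hg : g ∈ Γ) (hg' : g ∈ Λ) {x : E n} :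
    g x ∈ coincidence π ρ ↔ x ∈ coincidence π ρ := by
  have h1 := hπ.dist_apply_self hg x
  have h2 := hρ.dist_apply_self hg' x
  have e1 := dist_comm (π x) (π (g x))
  have e2 := dist_comm (ρ x) (ρ (g x))
  constructor
  · intro h
    refine le_antisymm ((dist_triangle4 _ (π (g x)) (ρ (g x)) _).trans ?_) dist_nonneg
    rw [h1, ← e2, h2, show dist _ _ = 0 from h]; simp
  · intro h
    refine le_antisymm ((dist_triangle4 _ (π x) (ρ x) _).trans ?_) dist_nonneg
    rw [h2, ← e1, h1, show dist _ _ = 0 from h]; simp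

/-- The coincidence set contains the Dirichlet domain of each of its interior points. -/
theorem mem_coincidence_of_isMin (hπ : IsOrbitMap Γ π) (hρ : IsOrbitMap Λ ρ) {x y : E n}
    (hy : y ∈ interior (coincidence π ρ)) (hmin : ∀ g ∈ Γ, dist x y ≤ dist (g x) y) :
    x ∈ coincidence π ρ := by
  obtain ⟨t, ht0, ht1, ht⟩ : ∃ t : ℝ, 0 < t ∧ t ≤ 1 ∧
      AffineMap.lineMap y x t ∈ coincidence π ρ := by
    have hlim : Filter.Tendsto (fun t : ℝ => AffineMap.lineMap y x t) (𝓝[>] 0) (𝓝 y) := by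
      have : Filter.Tendsto (fun t : ℝ => AffineMap.lineMap y x t) (𝓝 0)
          (𝓝 (AffineMap.lineMap y x (0 : ℝ))) :=
        (AffineMap.lineMap_continuous (p := y) (q := x)).tendsto 0
      rw [AffineMap.lineMap_apply_zero] at this
      exact this.mono_left nhdsWithin_le_nhds
    obtain ⟨t, ht, ht0, ht1⟩ := ((hlim.eventually (mem_interior_iff_mem_nhds.1 hy)).and
      (Ioc_mem_nhdsGT (zero_lt_one' ℝ))).exists
    exact ⟨t, ht0, ht1, ht⟩
  have hy' : y ∈ coincidence π ρ := interior_subset hy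
  change dist (π y) (ρ y) = 0 at hy'
  set z := (AffineMap.lineMap y x t : E n) with hz
  have hz' : dist (π z) (ρ z) = 0 := ht
  -- The translate `l x'` is no farther from `z` than `x` is, but no closer to `y`. As `z` lies on
  -- the segment from `y` to `x`, equality in the triangle inequality forces `l x' = x`.
  obtain ⟨x', hx'⟩ := hρ.surjective (π x)
  obtain ⟨l, hl, hlz⟩ := hρ.exists_dist_eq x' z
  have hwz : dist (l x') z ≤ dist x z := by
    rw [← hlz, hx']
    refine (dist_triangle _ (π z) _).trans ?_
    rw [hz', add_zero]
    exact hπ.dist_le_dist x z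
  have hwy : dist x y ≤ dist (l x') y := by
    obtain ⟨g, hg, hgy⟩ := hπ.exists_dist_eq x y
    refine (hmin g hg).trans (hgy.symm.le.trans ((dist_triangle _ (ρ y) _).trans ?_))
    rw [dist_comm (ρ y), hy', add_zero, ← hx']
    exact hρ.dist_le l hl x' y
  have hyz : dist y z = t * dist x y := by
    rw [hz, dist_left_lineMap, Real.norm_of_nonneg ht0.le, dist_comm]
  have hzx : dist x z = (1 - t) * dist x y := by
    rw [hz, dist_right_lineMap, Real.norm_of_nonneg (by linarith), dist_comm]
  have htri := dist_triangle (l x') z y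
  rw [dist_comm z y] at htri
  have hw : dist (l x') y = dist x y := by linarith
  have hz2 : z = AffineMap.lineMap y (l x') t :=
    eq_lineMap_of_dist_eq_mul_of_dist_eq_mul (by rw [dist_comm y (l x'), hw, hyz]) (by
      rw [dist_comm z, dist_comm y (l x'), hw]; linarith)
  have : x = l x' := by
    rw [hz, AffineMap.lineMap_apply, AffineMap.lineMap_apply] at hz2
    simp only [vsub_eq_sub, vadd_eq_add, add_left_inj] at hz2
    exact sub_left_injective (smul_right_injective _ ht0.ne' hz2)
  have hfin := hρ.dist_apply_self hl x'
  rwa [← this, hx'] at hfin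

/-- A point `x` near `c` can be moved by the stabilizer of `c` into the Dirichlet domain of a nearby
interior point `y`. The moving element lies in both groups, so it preserves the coincidence set. -/
theorem mem_interior_coincidence (hΓ : IsProperlyDiscontinuous Γ) (hπ : IsOrbitMap Γ π)
    (hρ : IsOrbitMap Λ ρ) {c : E n} (hc : c ∈ closure (interior (coincidence π ρ)))
    (hfix : ∀ g ∈ Γ, g c = c → g ∈ Λ) : c ∈ interior (coincidence π ρ) := by
  obtain ⟨r, hr, hrfix⟩ := hΓ.exists_fix_radius c
  obtain ⟨y, hy, hyc⟩ := Metric.mem_closure_iff.1 hc (r / 4) (by positivity)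
  rw [mem_interior_iff_mem_nhds]
  filter_upwards [Metric.ball_mem_nhds c (show 0 < r / 4 by positivity)] with x hx
  rw [Metric.mem_ball] at hx
  obtain ⟨g, hg, hmin⟩ := hΓ.exists_isMin x y (S := Γ) subset_rfl ⟨1, Γ.one_mem⟩
  have hgx : dist (g x) y ≤ dist x y := hmin 1 Γ.one_mem
  have hgc : g c = c := by
    refine hrfix g hg ?_
    have h1 := dist_triangle4 (g c) (g x) y c
    rw [g.dist_eq, dist_comm c x, dist_comm y c] at h1
    have h2 := dist_triangle x c y
    linarith
  rw [← apply_mem_coincidence_iff hπ hρ hg (hfix g hg hgc)]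
  refine mem_coincidence_of_isMin hπ hρ hy fun g' hg' => ?_
  rw [← IsometryEquiv.mul_apply]
  exact hmin _ (Γ.mul_mem hg' hg)

/-- Agreement spreads along a generic segment. It could stop at a point only if that point were
fixed both by some element of `Γ` outside `Λ` and by some element of `Λ` outside `Γ`; by Baire, a
segment to a point outside the set can avoid all such common fixed points. -/
theorem coincidence_eq_univ (hΓ : IsProperlyDiscontinuous Γ) (hΛ : IsProperlyDiscontinuous Λ)
    (hπ : IsOrbitMap Γ π) (hρ : IsOrbitMap Λ ρ)
    (hne : (interior (coincidence π ρ)).Nonempty) : coincidence π ρ = Set.univ := by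
  by_contra hcon
  have := hΓ.countable
  have := hΛ.countable
  obtain ⟨p, hp, hpfix⟩ := exists_mem_forall_apply_ne
    (S := ((Γ : Set (E n ≃ᵢ E n)) ∪ Λ) \ {1})
    (((Set.to_countable _).union (Set.to_countable _)).mono Set.sdiff_subset) (by simp)
    isOpen_interior hne
  have hW : ∀ ab : Γ × Λ, ∃ W : Submodule ℝ (E n), W ≠ ⊤ ∧
      ((ab.1 : E n ≃ᵢ E n) ∉ Λ → (ab.2 : E n ≃ᵢ E n) ∉ Γ → ∀ (q : E n) (t : ℝ), t ≠ 0 →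
      (ab.1 : E n ≃ᵢ E n) (AffineMap.lineMap p q t) = AffineMap.lineMap p q t →
      (ab.2 : E n ≃ᵢ E n) (AffineMap.lineMap p q t) = AffineMap.lineMap p q t → q - p ∈ W) := by
    rintro ⟨a, b⟩
    by_cases ha : (a : E n ≃ᵢ E n) ∈ Λ
    · obtain ⟨q, hq⟩ := (Set.ne_univ_iff_exists_notMem _).1 hcon
      refine ⟨⊥, fun h => ?_, fun h => absurd ha h⟩
      have : Subsingleton (E n) := by
        rwa [← Submodule.subsingleton_iff ℝ, ← subsingleton_iff_bot_eq_top]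
      exact hq (Subsingleton.elim p q ▸ interior_subset hp)
    by_cases hb : (b : E n ≃ᵢ E n) ∈ Γ
    · obtain ⟨q, hq⟩ := (Set.ne_univ_iff_exists_notMem _).1 hcon
      refine ⟨⊥, fun h => ?_, fun _ h => absurd hb h⟩
      have : Subsingleton (E n) := by
        rwa [← Submodule.subsingleton_iff ℝ, ← subsingleton_iff_bot_eq_top]
      exact hq (Subsingleton.elim p q ▸ interior_subset hp)
    obtain ⟨W, hW, hW'⟩ := exists_submodule_of_fixed (a := (a : E n ≃ᵢ E n)) (b := b) (p := p)
      (fun h => ha (h ▸ b.2))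
      (hpfix a ⟨Or.inl a.2, fun h => ha (by rw [Set.mem_singleton_iff.1 h]; exact Λ.one_mem)⟩)
      (hpfix b ⟨Or.inr b.2, fun h => hb (by rw [Set.mem_singleton_iff.1 h]; exact Γ.one_mem)⟩)
    exact ⟨W, hW, fun _ _ => hW'⟩
  choose W hWtop hW using hW
  have hdense : Dense (⋂ ab, {q | q - p ∈ W ab}ᶜ) := by
    refine dense_iInter_of_isOpen (fun ab => ?_) fun ab => ?_
    · exact ((W ab).closed_of_finiteDimensional.preimage
        (continuous_id.sub continuous_const)).isOpen_compl
    · have h1 : Dense ((W ab : Set (E n))ᶜ) := by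
        rw [← interior_eq_empty_iff_dense_compl]
        by_contra h
        exact hWtop ab ((W ab).eq_top_of_nonempty_interior' (Set.nonempty_iff_ne_empty.2 h))
      exact h1.preimage (Homeomorph.subRight p).isOpenMap
  obtain ⟨q, hq, hqW⟩ := hdense.inter_open_nonempty _ (isClosed_coincidence hπ hρ).isOpen_compl
    (Set.nonempty_compl.2 hcon)
  rw [Set.mem_iInter] at hqW
  refine hq (interior_subset (?_ : q ∈ interior (coincidence π ρ)))
  have hseg : segment ℝ p q ⊆ interior (coincidence π ρ) := by
    refine IsPreconnected.subset_of_closure_inter_subset (convex_segment p q).isPreconnected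
      isOpen_interior ⟨p, left_mem_segment ℝ p q, hp⟩ ?_
    rintro c ⟨hc, hcs⟩
    rw [segment_eq_image_lineMap] at hcs
    obtain ⟨t, -, rfl⟩ := hcs
    by_cases ht : t = 0
    · rw [ht, AffineMap.lineMap_apply_zero]; exact hp
    by_contra hcint
    obtain ⟨a, ha, hac, haΛ⟩ : ∃ a ∈ Γ, a (AffineMap.lineMap p q t) = AffineMap.lineMap p q t ∧
        a ∉ Λ := by
      by_contra! h
      exact hcint (mem_interior_coincidence hΓ hπ hρ hc h)
    obtain ⟨b, hb, hbc, hbΓ⟩ : ∃ b ∈ Λ, b (AffineMap.lineMap p q t) = AffineMap.lineMap p q t ∧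
        b ∉ Γ := by
      by_contra! h
      rw [coincidence_comm] at hc hcint
      exact hcint (mem_interior_coincidence hΛ hρ hπ hc h)
    exact hqW (⟨a, ha⟩, ⟨b, hb⟩) (hW (⟨a, ha⟩, ⟨b, hb⟩) haΛ hbΓ q t ht hac hbc)
  exact hseg (right_mem_segment ℝ p q)

end IsOrbitMap

variable {Γ : Subgroup (E n ≃ᵢ E n)}

/-- Near a point with trivial stabilizer the quotient map is an isometry. -/
theorem exists_injectivity_radius (hΓ : IsProperlyDiscontinuous Γ) {p : E n}
    (hp : ∀ g ∈ Γ, g p = p → g = 1) : ∃ r > 0,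
      (∀ x ∈ Metric.ball p r, ∀ y ∈ Metric.ball p r, ∀ g ∈ Γ, dist (g x) y < r → g = 1) ∧
      ∀ x ∈ Metric.ball p r, ∀ y ∈ Metric.ball p r,
        dist (OrbitSpace.mk Γ x) (OrbitSpace.mk Γ y) = dist x y := by
  obtain ⟨r, hr, hfix⟩ := hΓ.exists_fix_radius p
  have key : ∀ x ∈ Metric.ball p (r / 4), ∀ y ∈ Metric.ball p (r / 4), ∀ g ∈ Γ,
      dist (g x) y < r / 2 → g = 1 := by
    intro x hx y hy g hg hlt
    rw [Metric.mem_ball] at hx hy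
    refine hp g hg (hfix g hg ?_)
    have := dist_triangle4 (g p) (g x) y p
    rw [g.dist_eq, dist_comm p x] at this
    linarith
  refine ⟨r / 4, by positivity, fun x hx y hy g hg h => key x hx y hy g hg (by linarith), ?_⟩
  intro x hx y hy
  obtain ⟨g, hg, hd⟩ := hΓ.exists_dist_eq x y
  have h1 := dist_mk_le (Γ := Γ) x y Γ.one_mem
  have : g = 1 := by
    refine key x hx y hy g hg ?_
    rw [← hd]
    rw [Metric.mem_ball] at hx hy
    refine h1.trans_lt ((dist_triangle_right x y p).trans_lt ?_)
    linarith
  rw [hd, this]; rfl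

theorem isProperlyDiscontinuous_map_conj (hΓ : IsProperlyDiscontinuous Γ) (g : E n ≃ᵢ E n) :
    IsProperlyDiscontinuous (Γ.map (MulAut.conj g⁻¹).toMonoidHom) := by
  intro x r
  refine ((hΓ (g x) r).image (MulAut.conj g⁻¹)).subset ?_
  rintro _ ⟨⟨h, hh, rfl⟩, hd⟩
  refine ⟨h, ⟨hh, ?_⟩, rfl⟩
  have e : ((MulAut.conj g⁻¹).toMonoidHom h : E n ≃ᵢ E n) x = g⁻¹ (h (g x)) := by
    simp [IsometryEquiv.mul_apply]
  rw [e, ← g.dist_eq, IsometryEquiv.apply_inv_self] at hd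
  exact hd

theorem exists_trivial_stabilizer (hΓ : IsProperlyDiscontinuous Γ) {U : Set (E n)}
    (hU : IsOpen U) (hne : U.Nonempty) : ∃ x ∈ U, ∀ g ∈ Γ, g x = x → g = 1 := by
  have := hΓ.countable
  obtain ⟨x, hx, h⟩ := exists_mem_forall_apply_ne (S := (Γ : Set (E n ≃ᵢ E n)) \ {1})
    ((Set.to_countable _).mono Set.sdiff_subset) (by simp) hU hne
  refine ⟨x, hx, fun g hg hgx => ?_⟩
  by_contra hg1
  exact h g ⟨hg, hg1⟩ hgx

theorem exists_isometric_lift (hΓ : IsProperlyDiscontinuous Γ) (ζ : IsomOrbit Γ) :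
    ∃ g : E n ≃ᵢ E n, IsLift Γ g ζ := by
  obtain ⟨p₀, -, hp₀⟩ := exists_trivial_stabilizer hΓ isOpen_univ ⟨(0 : E n), trivial⟩
  obtain ⟨r₀, hr₀, hr₀1, -⟩ := exists_injectivity_radius hΓ hp₀
  obtain ⟨q₀, hq₀⟩ := OrbitSpace.mk_surjective (ζ (OrbitSpace.mk Γ p₀))
  -- The point `q₀` may have nontrivial stabilizer, so it is perturbed; the corresponding `p`
  -- remains within the radius `r₀` of `p₀`, where stabilizers are trivial.
  obtain ⟨q, hq, hqfix⟩ := exists_trivial_stabilizer hΓ Metric.isOpen_ball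
    ⟨q₀, Metric.mem_ball_self hr₀⟩
  obtain ⟨p, hp, hζp⟩ : ∃ p ∈ Metric.ball p₀ r₀, ζ (OrbitSpace.mk Γ p) = OrbitSpace.mk Γ q := by
    obtain ⟨p', hp'⟩ := OrbitSpace.mk_surjective (ζ.symm (OrbitSpace.mk Γ q))
    obtain ⟨g, hg, hd⟩ := hΓ.exists_dist_eq p' p₀
    refine ⟨g p', ?_, by rw [mk_apply hg, hp', ζ.apply_symm_apply]⟩
    rw [Metric.mem_ball, ← hd, hp', ← ζ.dist_eq, ζ.apply_symm_apply, ← hq₀]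
    exact (dist_mk_le q q₀ Γ.one_mem).trans_lt hq
  have hpfix : ∀ g ∈ Γ, g p = p → g = 1 := fun g hg hgp =>
    hr₀1 p hp p hp g hg (by rw [hgp, dist_self]; exact hr₀)
  obtain ⟨r₁, hr₁, -, h₁⟩ := exists_injectivity_radius hΓ hpfix
  obtain ⟨r₂, hr₂, -, h₂⟩ := exists_injectivity_radius hΓ hqfix
  set r := min r₁ r₂
  have hr : 0 < r := lt_min hr₁ hr₂
  have hex : ∀ x ∈ Metric.ball p r, ∃ x' ∈ Metric.ball q r,
      OrbitSpace.mk Γ x' = ζ (OrbitSpace.mk Γ x) := by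
    intro x hx
    obtain ⟨y, hy⟩ := OrbitSpace.mk_surjective (ζ (OrbitSpace.mk Γ x))
    obtain ⟨g, hg, hd⟩ := hΓ.exists_dist_eq y q
    refine ⟨g y, ?_, by rw [mk_apply hg, hy]⟩
    rw [Metric.mem_ball, ← hd, hy, ← hζp, ζ.dist_eq]
    exact (dist_mk_le x p Γ.one_mem).trans_lt hx
  choose! h hhq hh using hex
  obtain ⟨g, hg⟩ := exists_isometry_eqOn_ball (h := h) hr fun x hx y hy => by
    rw [← h₂ _ (Metric.ball_subset_ball (min_le_right _ _) (hhq x hx)) _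
      (Metric.ball_subset_ball (min_le_right _ _) (hhq y hy)), hh x hx, hh y hy, ζ.dist_eq,
      h₁ _ (Metric.ball_subset_ball (min_le_left _ _) hx) _
      (Metric.ball_subset_ball (min_le_left _ _) hy)]
  refine ⟨g, fun x => ?_⟩
  -- Transported through `g` and `ζ`, the quotient map becomes an orbit map for `g⁻¹Γg`, and it
  -- agrees with the original one near `p`.
  have hρ : IsOrbitMap (Γ.map (MulAut.conj g⁻¹).toMonoidHom)
      (fun x => ζ.symm (OrbitSpace.mk Γ (g x))) := by
    refine ⟨ζ.symm.surjective.comp (OrbitSpace.mk_surjective.comp g.surjective), ?_, ?_⟩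
    · rintro _ ⟨k, hk, rfl⟩ x y
      rw [ζ.symm.dist_eq, ← g.dist_eq _ y]
      simpa [IsometryEquiv.mul_apply] using dist_mk_le (g x) (g y) hk
    · intro x y
      obtain ⟨k, hk, hd⟩ := hΓ.exists_dist_eq (g x) (g y)
      refine ⟨_, ⟨k, hk, rfl⟩, ?_⟩
      rw [ζ.symm.dist_eq, ← g.dist_eq _ y, hd]
      simp [IsometryEquiv.mul_apply]
  have huniv := IsOrbitMap.coincidence_eq_univ hΓ (isProperlyDiscontinuous_map_conj hΓ g)
    (isOrbitMap_mk hΓ) hρ ⟨p, by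
      rw [mem_interior_iff_mem_nhds]
      filter_upwards [Metric.ball_mem_nhds p hr] with x hx
      change dist _ (ζ.symm (OrbitSpace.mk Γ (g x))) = 0
      rw [hg x hx, hh x hx, ζ.symm_apply_apply, dist_self]⟩
  have hx : dist (OrbitSpace.mk Γ x) (ζ.symm (OrbitSpace.mk Γ (g x))) = 0 :=
    Set.eq_univ_iff_forall.1 huniv x
  rw [← ζ.dist_eq, ζ.apply_symm_apply] at hx
  obtain ⟨y, hy⟩ := OrbitSpace.mk_surjective (ζ (OrbitSpace.mk Γ x))
  rw [← hy] at hx ⊢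
  exact mk_eq_of_dist_eq_zero hΓ hx

end Lifting

/-! ### Normalizing maps and the maps they induce on the orbit space -/

section Conjugation

variable {X : Type*} [PseudoMetricSpace X] {Γ : Subgroup (X ≃ᵢ X)}

theorem toPerm_injective : Function.Injective (toPerm : (X ≃ᵢ X) →* Equiv.Perm X) :=
  fun _ _ e => IsometryEquiv.ext fun x => congrArg (fun σ : Equiv.Perm X => σ x) e

@[simp] theorem toPerm_apply (g : X ≃ᵢ X) (x : X) : toPerm g x = g x := rfl

theorem isConjugationBy_iff {α : Equiv.Perm X} {φ : MulAut Γ} :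
    IsConjugationBy α φ ↔ ∀ (γ : Γ) (x : X), (φ γ : X ≃ᵢ X) (α x) = α ((γ : X ≃ᵢ X) x) := by
  refine forall_congr' fun γ => ?_
  rw [eq_mul_inv_iff_mul_eq, Equiv.ext_iff]
  rfl

theorem exists_isConjugationBy {α : Equiv.Perm X}
    (h₁ : ∀ γ ∈ Γ, ∃ γ' ∈ Γ, toPerm γ' = α * toPerm γ * α⁻¹)
    (h₂ : ∀ γ ∈ Γ, ∃ γ' ∈ Γ, toPerm γ' = α⁻¹ * toPerm γ * α) :
    ∃ φ : MulAut Γ, IsConjugationBy α φ := by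
  choose! F hF hF' using h₁
  choose! G hG hG' using h₂
  refine ⟨{ toFun := fun γ => ⟨F γ, hF γ γ.2⟩
            invFun := fun γ => ⟨G γ, hG γ γ.2⟩
            left_inv := fun γ => Subtype.ext (toPerm_injective ?_)
            right_inv := fun γ => Subtype.ext (toPerm_injective ?_)
            map_mul' := fun γ δ => Subtype.ext (toPerm_injective ?_) }, fun γ => hF' γ γ.2⟩
  · change toPerm (G (F γ)) = _
    rw [hG' _ (hF γ γ.2), hF' γ γ.2]; group
  · change toPerm (F (G γ)) = _
    rw [hF' _ (hG γ γ.2), hG' γ γ.2]; group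
  · change toPerm (F (γ * δ : Γ)) = toPerm (F γ * F δ)
    rw [hF' _ (γ * δ).2, map_mul, hF' γ γ.2, hF' δ δ.2, Subgroup.coe_mul, map_mul]; group

namespace IsConjugationBy

variable {α β : Equiv.Perm X} {φ ψ : MulAut Γ}

theorem mul (hα : IsConjugationBy α φ) (hβ : IsConjugationBy β ψ) :
    IsConjugationBy (α * β) (φ * ψ) := fun γ => by
  rw [MulAut.mul_apply, hα, hβ]; group

theorem inv (hα : IsConjugationBy α φ) : IsConjugationBy α⁻¹ φ⁻¹ := fun γ => by
  have := hα (φ⁻¹ γ)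
  rw [MulAut.apply_inv_self] at this
  rw [this]; group

theorem unique (hα : IsConjugationBy α φ) (hα' : IsConjugationBy α ψ) : φ = ψ := by
  ext1 γ
  exact Subtype.ext (toPerm_injective ((hα γ).trans (hα' γ).symm))

theorem conj (γ : Γ) : IsConjugationBy (toPerm (γ : X ≃ᵢ X)) (MulAut.conj γ) := fun δ => by
  simp [MulAut.conj_apply]

/-- A map normalizing the group descends to the orbit space. -/
theorem mk_apply_eq_iff (hα : IsConjugationBy α φ) {x y : X} :
    OrbitSpace.mk Γ (α x) = OrbitSpace.mk Γ (α y) ↔ OrbitSpace.mk Γ x = OrbitSpace.mk Γ y := by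
  rw [OrbitSpace.mk_eq_iff, OrbitSpace.mk_eq_iff]
  rw [isConjugationBy_iff] at hα
  constructor
  · rintro ⟨γ, hγ⟩
    refine ⟨φ⁻¹ γ, α.injective ?_⟩
    rw [← hα, MulAut.apply_inv_self, hγ]
  · rintro ⟨γ, hγ⟩
    exact ⟨φ γ, by rw [hα, hγ]⟩

theorem exists_perm (hα : IsConjugationBy α φ) :
    ∃ β : Equiv.Perm (OrbitSpace Γ), IsLift Γ α β := by
  let f : OrbitSpace Γ → OrbitSpace Γ := fun p =>
    Quotient.liftOn p (fun x => OrbitSpace.mk Γ (α x)) fun _ _ h =>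
      hα.mk_apply_eq_iff.2 (Quotient.sound h)
  have hf : ∀ x, f (OrbitSpace.mk Γ x) = OrbitSpace.mk Γ (α x) := fun x => rfl
  refine ⟨Equiv.ofBijective f ⟨fun p q h => ?_, fun p => ?_⟩, hf⟩
  · obtain ⟨x, rfl⟩ := OrbitSpace.mk_surjective p
    obtain ⟨y, rfl⟩ := OrbitSpace.mk_surjective q
    rwa [hf, hf, hα.mk_apply_eq_iff] at h
  · obtain ⟨x, rfl⟩ := OrbitSpace.mk_surjective p
    exact ⟨OrbitSpace.mk Γ (α⁻¹ x), by rw [hf]; simp⟩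

theorem exists_isom {g : X ≃ᵢ X} (hg : IsConjugationBy (toPerm g) φ) :
    ∃ ζ : OrbitSpace Γ ≃ᵢ OrbitSpace Γ, IsLift Γ g ζ := by
  obtain ⟨β, hβ⟩ := hg.exists_perm
  refine ⟨IsometryEquiv.mk β (Isometry.of_dist_eq fun p q => ?_), hβ⟩
  obtain ⟨x, rfl⟩ := OrbitSpace.mk_surjective p
  obtain ⟨y, rfl⟩ := OrbitSpace.mk_surjective q
  change dist (β (OrbitSpace.mk Γ x)) (β (OrbitSpace.mk Γ y)) = _
  rw [hβ, hβ]
  change (⨅ γ : Γ, dist (g x) ((γ : X ≃ᵢ X) (g y))) = ⨅ γ : Γ, dist x ((γ : X ≃ᵢ X) y)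
  refine (Function.Surjective.iInf_congr φ φ.surjective fun γ => ?_).symm
  have := isConjugationBy_iff.1 hg γ y
  simp only [toPerm_apply] at this
  rw [this, g.dist_eq]

end IsConjugationBy

namespace IsLift

variable {α α' : X → X} {β β' : OrbitSpace Γ → OrbitSpace Γ}

theorem comp (h : IsLift Γ α β) (h' : IsLift Γ α' β') : IsLift Γ (α ∘ α') (β ∘ β') := fun x => by
  rw [Function.comp_apply, h' x, h (α' x)]; rfl

theorem perm_inv {α : Equiv.Perm X} {β : Equiv.Perm (OrbitSpace Γ)} (h : IsLift Γ α β) :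
    IsLift Γ (α⁻¹ : Equiv.Perm X) (β⁻¹ : Equiv.Perm (OrbitSpace Γ)) := fun x => by
  rw [Equiv.Perm.inv_eq_iff_eq, h]; simp

theorem eq_of_eq (h : IsLift Γ α β) (h' : IsLift Γ α β') : β = β' := by
  funext p
  obtain ⟨x, rfl⟩ := OrbitSpace.mk_surjective p
  rw [h, h']

end IsLift

end Conjugation

/-! ### Affine lifts normalize the group -/

section AffineLifts

variable {n : ℕ} {Γ : Subgroup (E n ≃ᵢ E n)}

/-- Countably many closed sets, one for each group element, cover the space; by Baire one has
interior, and affine maps agreeing on an open set are equal. -/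
theorem exists_eq_of_isLift_id (hΓ : IsProperlyDiscontinuous Γ) {α : E n →ᵃ[ℝ] E n}
    (h : IsLift Γ α id) : ∃ γ ∈ Γ, ∀ x, γ x = α x := by
  have := hΓ.countable
  obtain ⟨γ, p, hp⟩ := nonempty_interior_of_iUnion_of_closed
    (f := fun γ : Γ => {x | (γ : E n ≃ᵢ E n) x = α x})
    (fun γ => isClosed_eq (γ : E n ≃ᵢ E n).continuous α.continuous_of_finiteDimensional)
    (Set.eq_univ_of_forall fun x => by
      obtain ⟨γ, hγ⟩ := OrbitSpace.mk_eq_iff.1 (h x)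
      refine Set.mem_iUnion.2 ⟨γ⁻¹, ?_⟩
      refine (γ : E n ≃ᵢ E n).injective ?_
      rw [hγ]
      exact (γ : E n ≃ᵢ E n).apply_inv_self x)
  refine ⟨γ, γ.2, fun x => ?_⟩
  have := affineMap_eq_of_eventuallyEq (f := (affine (γ : E n ≃ᵢ E n)).toAffineMap) (g := α) (p := p) (by
    filter_upwards [mem_interior_iff_mem_nhds.1 hp] with x hx
    simpa using hx)
  simpa using DFunLike.congr_fun this x

theorem exists_toPerm_eq_of_isLift_one (hΓ : IsProperlyDiscontinuous Γ) {α : E n ≃ᵃ[ℝ] E n}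
    (h : IsLift Γ α id) : ∃ γ ∈ Γ, toPerm γ = α.toEquiv := by
  obtain ⟨γ, hγ, e⟩ := exists_eq_of_isLift_id hΓ (α := (α : E n →ᵃ[ℝ] E n)) h
  exact ⟨γ, hγ, Equiv.ext e⟩

/-- The conjugate of a group element by `α` is an affine lift of the identity; the same applies to
the inverse of `α`. -/
theorem exists_isConjugationBy_of_isLift (hΓ : IsProperlyDiscontinuous Γ) {α : E n ≃ᵃ[ℝ] E n}
    {β : Equiv.Perm (OrbitSpace Γ)} (h : IsLift Γ α β) :
    ∃ φ : MulAut Γ, IsConjugationBy α.toEquiv φ := by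
  have key : ∀ (α : E n ≃ᵃ[ℝ] E n) (β : Equiv.Perm (OrbitSpace Γ)), IsLift Γ α β →
      ∀ γ ∈ Γ, ∃ γ' ∈ Γ, toPerm γ' = α.toEquiv * toPerm γ * (α.toEquiv : Equiv.Perm (E n))⁻¹ := by
    intro α β h γ hγ
    obtain ⟨γ', hγ', e⟩ := exists_toPerm_eq_of_isLift_one hΓ
      (α := (α.symm.trans (affine γ)).trans α) (fun x => by
        have h1 : OrbitSpace.mk Γ (α (γ (α.symm x))) = OrbitSpace.mk Γ (α (α.symm x)) := by
          rw [← h, ← h, mk_apply hγ]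
        rw [AffineEquiv.apply_symm_apply] at h1
        simpa using h1.symm)
    refine ⟨γ', hγ', e.trans (Equiv.ext fun x => ?_)⟩
    change α (affine γ (α.symm x)) = _
    rw [affine_apply]; rfl
  refine exists_isConjugationBy (key α β h) fun γ hγ => ?_
  exact key α.symm β⁻¹ (IsLift.perm_inv (α := α.toEquiv) h) γ hγ

theorem class_eq_of_isLift (hΓ : IsProperlyDiscontinuous Γ) {α α' : E n ≃ᵃ[ℝ] E n}
    {β : Equiv.Perm (OrbitSpace Γ)} (h : IsLift Γ α β) (h' : IsLift Γ α' β) {φ φ' : MulAut Γ}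
    (hφ : IsConjugationBy α.toEquiv φ) (hφ' : IsConjugationBy α'.toEquiv φ') :
    φ⁻¹ * φ' ∈ Inn Γ := by
  obtain ⟨γ, hγ, e⟩ := exists_toPerm_eq_of_isLift_one hΓ (α := α'.trans α.symm) (fun x => by
    have h1 := (IsLift.perm_inv (α := α.toEquiv) h).comp h' x
    simpa using h1)
  refine ⟨⟨γ, hγ⟩, (IsConjugationBy.conj ⟨γ, hγ⟩).unique ?_⟩
  change IsConjugationBy (toPerm γ) _
  rw [e]
  exact hφ.inv.mul hφ'

end AffineLifts

/-! ### Bieberbach's second theorem and rigidity near the identity -/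

section AffineRealization

variable {n : ℕ} {Γ : Subgroup (E n ≃ᵢ E n)}

/-- The translation by a lattice vector as an element of the group. -/
noncomputable def latticeTranslation (Γ : Subgroup (E n ≃ᵢ E n)) (v : translationLattice Γ) : Γ :=
  ⟨translation v, v.2⟩

@[simp] theorem coe_latticeTranslation (v : translationLattice Γ) :
    (latticeTranslation Γ v : E n ≃ᵢ E n) = translation v := rfl

theorem latticeTranslation_add (v w : translationLattice Γ) :
    latticeTranslation Γ (v + w) = latticeTranslation Γ v * latticeTranslation Γ w :=
  Subtype.ext (translation_add _ _)

theorem latticeTranslation_nsmul (k : ℕ) (v : translationLattice Γ) :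
    latticeTranslation Γ (k • v) = latticeTranslation Γ v ^ k := by
  induction k with
  | zero => rw [zero_smul, pow_zero]; exact Subtype.ext translation_zero
  | succ k ih => rw [succ_nsmul, pow_succ, latticeTranslation_add, ih]

theorem exists_latticeTranslation_eq {γ : Γ} (h : rot (γ : E n ≃ᵢ E n) = 1) :
    ∃ v, γ = latticeTranslation Γ v := by
  have := eq_translation_of_rot_eq_one h
  exact ⟨⟨(γ : E n ≃ᵢ E n) 0, by rw [mem_translationLattice, ← this]; exact γ.2⟩, Subtype.ext this⟩

theorem finite_map_rot (hd : IsProperlyDiscontinuous Γ) (hc : IsCocompact Γ) :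
    Finite (Γ.map rot) :=
  (finite_image_rot hd hc).to_subtype

theorem exists_pow_eq_latticeTranslation (hd : IsProperlyDiscontinuous Γ) (hc : IsCocompact Γ)
    (γ : Γ) : ∃ k : ℕ, 0 < k ∧ ∃ v, γ ^ k = latticeTranslation Γ v := by
  have := finite_map_rot hd hc
  refine ⟨Nat.card (Γ.map rot), Nat.card_pos, exists_latticeTranslation_eq ?_⟩
  have h := pow_card_eq_one' (x := (⟨rot γ, γ, γ.2, rfl⟩ : Γ.map rot))
  have := congrArg Subtype.val h
  simpa using this

theorem linear_ext_of_lattice (hd : IsProperlyDiscontinuous Γ) (hc : IsCocompact Γ)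
    {f g : E n →ₗ[ℝ] E n} (h : ∀ v ∈ translationLattice Γ, f v = g v) : f = g :=
  LinearMap.ext_on (span_translationLattice hd hc) h

theorem rot_eq_one_of_lattice (hd : IsProperlyDiscontinuous Γ) (hc : IsCocompact Γ)
    {g : E n ≃ᵢ E n} (h : ∀ v ∈ translationLattice Γ, rot g v = v) : rot g = 1 := by
  ext1 x
  exact LinearMap.congr_fun (linear_ext_of_lattice hd hc
    (f := (rot g).toLinearEquiv.toLinearMap) (g := LinearMap.id) h) x

theorem rot_apply_eq_of_commute {g : E n ≃ᵢ E n} {v : E n} (h : Commute g (translation v)) :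
    rot g v = v := by
  have h1 := conj_translation g v
  rw [h.eq, mul_inv_cancel_right] at h1
  simpa using congrArg (fun f : E n ≃ᵢ E n => f 0) h1.symm

/-- Automorphisms map translations to translations. -/
theorem rot_map_latticeTranslation (hd : IsProperlyDiscontinuous Γ) (hc : IsCocompact Γ)
    (φ : MulAut Γ) (v : translationLattice Γ) : rot (φ (latticeTranslation Γ v) : E n ≃ᵢ E n) = 1 := by
  refine rot_eq_one_of_lattice hd hc fun w hw => ?_
  -- Some power of the preimage of the translation by `w` is a translation, so it commutes with
  -- translation by `v`. Applying `φ`, the rotation in question fixes `k • w`, hence `w`.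
  obtain ⟨k, hk, u, hu⟩ := exists_pow_eq_latticeTranslation hd hc
    (φ⁻¹ (latticeTranslation Γ ⟨w, hw⟩))
  have h1 : φ (latticeTranslation Γ u) = latticeTranslation Γ (k • ⟨w, hw⟩) := by
    rw [← hu, map_pow, MulAut.apply_inv_self, latticeTranslation_nsmul]
  have h2 : Commute (φ (latticeTranslation Γ v)) (latticeTranslation Γ (k • ⟨w, hw⟩)) := by
    rw [← h1]
    have : Commute (latticeTranslation Γ v) (latticeTranslation Γ u) := by
      rw [commute_iff_eq, ← latticeTranslation_add, ← latticeTranslation_add, add_comm]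
    exact this.map φ
  have h3 := rot_apply_eq_of_commute (h2.map Γ.subtype)
  have h4 : (((k • ⟨w, hw⟩ : translationLattice Γ)) : E n) = (k : ℝ) • w := by
    simp [Nat.cast_smul_eq_nsmul]
  rw [h4, map_smul] at h3
  exact smul_right_injective _ (Nat.cast_ne_zero.2 hk.ne') h3

/-- Since `φ` takes translations to translations, it is additive on the lattice, and a ℤ-basis of
the lattice is an ℝ-basis of the space. -/
theorem exists_linearMap_of_mulAut (hd : IsProperlyDiscontinuous Γ) (hc : IsCocompact Γ)
    (φ : MulAut Γ) : ∃ B : E n →ₗ[ℝ] E n, ∀ v : translationLattice Γ,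
      (φ (latticeTranslation Γ v) : E n ≃ᵢ E n) = translation (B v) := by
  have := discreteTopology_translationLattice hd
  have : IsZLattice ℝ (translationLattice Γ) := ⟨span_translationLattice hd hc⟩
  have ht : ∀ v, (φ (latticeTranslation Γ v) : E n ≃ᵢ E n)
      = translation ((φ (latticeTranslation Γ v) : E n ≃ᵢ E n) 0) := fun v =>
    eq_translation_of_rot_eq_one (rot_map_latticeTranslation hd hc φ v)
  let f : translationLattice Γ →+ E n :=
    { toFun := fun v => (φ (latticeTranslation Γ v) : E n ≃ᵢ E n) 0
      map_zero' := by
        have : latticeTranslation Γ 0 = 1 := Subtype.ext translation_zero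
        rw [this, map_one]; rfl
      map_add' := fun v w => by
        rw [latticeTranslation_add, map_mul, Subgroup.coe_mul, IsometryEquiv.mul_apply, ht v]
        simp [add_comm] }
  let b := Module.Free.chooseBasis ℤ (translationLattice Γ)
  let b' := b.ofZLatticeBasis ℝ (translationLattice Γ)
  let B : E n →ₗ[ℝ] E n := b'.constr ℝ fun i => f (b i)
  have hB : (B.restrictScalars ℤ).comp (translationLattice Γ).subtype = f.toIntLinearMap := by
    refine b.ext fun i => ?_
    have h := b'.constr_basis ℝ (fun i => f (b i)) i
    rw [b.ofZLatticeBasis_apply ℝ] at h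
    exact h
  refine ⟨B, fun v => ?_⟩
  rw [ht v]
  exact congrArg translation (LinearMap.congr_fun hB v).symm

theorem exists_linearEquiv_of_mulAut (hd : IsProperlyDiscontinuous Γ) (hc : IsCocompact Γ)
    (φ : MulAut Γ) : ∃ B : E n ≃ₗ[ℝ] E n, ∀ v : translationLattice Γ,
      (φ (latticeTranslation Γ v) : E n ≃ᵢ E n) = translation (B v) := by
  obtain ⟨B, hB⟩ := exists_linearMap_of_mulAut hd hc φ
  have key : ∀ (φ : MulAut Γ) (B B' : E n →ₗ[ℝ] E n),
      (∀ v : translationLattice Γ,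
        (φ (latticeTranslation Γ v) : E n ≃ᵢ E n) = translation (B v)) →
      (∀ v : translationLattice Γ,
        (φ⁻¹ (latticeTranslation Γ v) : E n ≃ᵢ E n) = translation (B' v)) →
      B ∘ₗ B' = LinearMap.id := by
    intro φ B B' h h'
    refine linear_ext_of_lattice hd hc fun v hv => ?_
    have h1 := h' ⟨v, hv⟩
    have hmem : B' v ∈ translationLattice Γ := by
      rw [mem_translationLattice, ← h1]; exact Subtype.prop _
    have h2 : φ⁻¹ (latticeTranslation Γ ⟨v, hv⟩) = latticeTranslation Γ ⟨B' v, hmem⟩ :=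
      Subtype.ext h1
    have h3 := h ⟨B' v, hmem⟩
    rw [← h2, MulAut.apply_inv_self] at h3
    simpa using congrArg (fun f : E n ≃ᵢ E n => f 0) h3.symm
  obtain ⟨B', hB'⟩ := exists_linearMap_of_mulAut hd hc φ⁻¹
  exact ⟨LinearEquiv.ofLinearMap B B' (key φ B B' hB hB')
    (key φ⁻¹ B' B hB' (by rwa [inv_inv])), hB⟩

theorem exists_affineEquiv_of_mulAut (hd : IsProperlyDiscontinuous Γ) (hc : IsCocompact Γ)
    (φ : MulAut Γ) : ∃ α : E n ≃ᵃ[ℝ] E n, IsConjugationBy α.toEquiv φ := by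
  obtain ⟨B, hB⟩ := exists_linearEquiv_of_mulAut hd hc φ
  have hBrot : ∀ (γ : Γ) (x : E n), B (rot (γ : E n ≃ᵢ E n) x) = rot (φ γ : E n ≃ᵢ E n) (B x) := by
    intro γ x
    refine LinearMap.congr_fun (linear_ext_of_lattice hd hc
      (f := B.toLinearMap ∘ₗ (rot (γ : E n ≃ᵢ E n)).toLinearEquiv.toLinearMap)
      (g := (rot (φ γ : E n ≃ᵢ E n)).toLinearEquiv.toLinearMap ∘ₗ B.toLinearMap) fun v hv => ?_) x
    have hr := rot_mem_translationLattice γ.2 hv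
    have h1 : latticeTranslation Γ ⟨_, hr⟩ = γ * latticeTranslation Γ ⟨v, hv⟩ * γ⁻¹ :=
      Subtype.ext (conj_translation _ _).symm
    have h2 := hB ⟨_, hr⟩
    rw [h1, map_mul, map_mul, map_inv, Subgroup.coe_mul, Subgroup.coe_mul, hB,
      Subgroup.coe_inv, conj_translation] at h2
    simpa using congrArg (fun f : E n ≃ᵢ E n => f 0) h2.symm
  -- The failure of `B` alone to realize `φ`. It is a cocycle that vanishes on translations, so it
  -- depends only on the rotation; its average `w` over the finite point group makes it a
  -- coboundary.
  let c : Γ → E n := fun γ => (φ γ : E n ≃ᵢ E n) 0 - B ((γ : E n ≃ᵢ E n) 0)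
  have hcmul : ∀ γ δ, c (γ * δ) = c γ + rot (φ γ : E n ≃ᵢ E n) (c δ) := by
    intro γ δ
    simp only [c, map_mul, Subgroup.coe_mul, IsometryEquiv.mul_apply]
    rw [apply_eq_rot (φ γ : E n ≃ᵢ E n) ((φ δ : E n ≃ᵢ E n) 0),
      apply_eq_rot (γ : E n ≃ᵢ E n) ((δ : E n ≃ᵢ E n) 0), map_add, hBrot, map_sub]
    abel
  have hcT : ∀ v, c (latticeTranslation Γ v) = 0 := fun v => by
    simp only [c]
    rw [hB]; simp
  have hcrot : ∀ γ δ : Γ, rot (γ : E n ≃ᵢ E n) = rot (δ : E n ≃ᵢ E n) → c γ = c δ := by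
    intro γ δ h
    obtain ⟨v, hv⟩ := exists_latticeTranslation_eq (γ := γ⁻¹ * δ) (by simp [h])
    rw [inv_mul_eq_iff_eq_mul] at hv
    rw [hv, hcmul, hcT, map_zero, add_zero]
  have := finite_map_rot hd hc
  have := Fintype.ofFinite (Γ.map rot)
  have hsec : ∀ p : Γ.map rot, ∃ γ : Γ, rot (γ : E n ≃ᵢ E n) = p := by
    rintro ⟨_, γ, hγ, rfl⟩
    exact ⟨⟨γ, hγ⟩, rfl⟩
  choose s hs using hsec
  set S := ∑ p, c (s p) with hS
  have hfix : ∀ γ : Γ, S = Fintype.card (Γ.map rot) • c γ + rot (φ γ : E n ≃ᵢ E n) S := by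
    intro γ
    have h1 : ∑ p, c (s ((⟨rot γ, γ, γ.2, rfl⟩ : Γ.map rot) * p)) = S :=
      Equiv.sum_comp (Equiv.mulLeft (⟨rot γ, γ, γ.2, rfl⟩ : Γ.map rot)) fun p => c (s p)
    have h2 : ∀ p : Γ.map rot, c (s ((⟨rot γ, γ, γ.2, rfl⟩ : Γ.map rot) * p))
        = c γ + rot (φ γ : E n ≃ᵢ E n) (c (s p)) := fun p => by
      rw [← hcmul]
      refine hcrot _ _ ?_
      rw [hs, Subgroup.coe_mul, Subgroup.coe_mul, map_mul, hs]
    rw [Finset.sum_congr rfl fun p _ => h2 p, Finset.sum_add_distrib, Finset.sum_const,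
      ← map_sum, Finset.card_univ] at h1
    exact h1.symm
  set N := Fintype.card (Γ.map rot)
  have hN : (N : ℝ) ≠ 0 := Nat.cast_ne_zero.2 Fintype.card_ne_zero
  set w := (N : ℝ)⁻¹ • S with hw
  have hwfix : ∀ γ : Γ, w = c γ + rot (φ γ : E n ≃ᵢ E n) w := fun γ => by
    rw [hw, map_smul]
    nth_rw 1 [hfix γ]
    rw [smul_add, ← Nat.cast_smul_eq_nsmul ℝ, inv_smul_smul₀ hN]
  refine ⟨B.toAffineEquiv.trans (AffineEquiv.constVAdd ℝ (E n) w), isConjugationBy_iff.2 ?_⟩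
  intro γ x
  change (φ γ : E n ≃ᵢ E n) (w + B x) = w + B ((γ : E n ≃ᵢ E n) x)
  rw [apply_eq_rot _ (w + B x), apply_eq_rot (γ : E n ≃ᵢ E n) x, map_add, map_add, hBrot]
  nth_rw 2 [hwfix γ]
  simp only [c]
  abel

/-- An affinity commuting with the group is translation by a vector fixed by the point group. -/
theorem eq_add_of_isConjugationBy_one (hd : IsProperlyDiscontinuous Γ) (hc : IsCocompact Γ)
    {α : E n ≃ᵃ[ℝ] E n} (h : IsConjugationBy α.toEquiv (1 : MulAut Γ)) :
    (∀ x, α x = x + α 0) ∧ ∀ γ ∈ Γ, rot γ (α 0) = α 0 := by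
  have hcomm : ∀ γ ∈ Γ, ∀ x, γ (α x) = α (γ x) := fun γ hγ x =>
    isConjugationBy_iff.1 h ⟨γ, hγ⟩ x
  have hlin : ∀ x, α x = α.linear x + α 0 := fun x => by
    simpa using α.map_vadd 0 x
  have h1 : α.linear.toLinearMap = LinearMap.id := linear_ext_of_lattice hd hc fun v hv => by
    have := hcomm _ hv 0
    rw [translation_apply, translation_apply, zero_add, hlin v, add_comm] at this
    exact (add_right_cancel this).symm
  have hx : ∀ x, α x = x + α 0 := fun x => by
    rw [hlin x]
    exact congrArg (· + α 0) (LinearMap.congr_fun h1 x)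
  refine ⟨hx, fun γ hγ => ?_⟩
  have := hcomm γ hγ 0
  rw [hx (γ 0), apply_eq_rot γ (α 0), add_comm] at this
  exact add_left_cancel this

theorem isConjugationBy_translation {w : E n} (hw : ∀ γ ∈ Γ, rot γ w = w) :
    IsConjugationBy (toPerm (translation w)) (1 : MulAut Γ) := by
  refine isConjugationBy_iff.2 fun γ x => ?_
  simp only [toPerm_apply, translation_apply, MulAut.one_apply]
  rw [apply_eq_rot _ (x + w), apply_eq_rot _ x, map_add, hw γ γ.2]
  abel

/-- Generators are a finite generating set of the lattice and one representative of each rotation.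
-/
theorem fg_of_isCocompact (hd : IsProperlyDiscontinuous Γ) (hc : IsCocompact Γ) : Γ.FG := by
  have := discreteTopology_translationLattice hd
  have : IsZLattice ℝ (translationLattice Γ) := ⟨span_translationLattice hd hc⟩
  obtain ⟨S, hS⟩ := ZLattice.FG ℝ (translationLattice Γ)
  have hrep : ∀ p ∈ rot '' (Γ : Set (E n ≃ᵢ E n)), ∃ g ∈ Γ, rot g = p := by
    rintro _ ⟨g, hg, rfl⟩; exact ⟨g, hg, rfl⟩
  choose! s hsΓ hs using hrep
  set F := translation '' (S : Set (E n)) ∪ s '' (rot '' (Γ : Set (E n ≃ᵢ E n)))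
  rw [Subgroup.fg_iff]
  refine ⟨F, le_antisymm ?_ ?_, (S.finite_toSet.image _).union ((finite_image_rot hd hc).image _)⟩
  · rw [Subgroup.closure_le]
    rintro _ (⟨v, hv, rfl⟩ | ⟨p, hp, rfl⟩)
    · have : v ∈ translationLattice Γ := hS ▸ Submodule.subset_span hv
      exact this
    · exact hsΓ p hp
  · have hT : translationLattice Γ ≤ translationLattice (Subgroup.closure F) := by
      rw [← hS, Submodule.span_le]
      exact fun v hv => Subgroup.subset_closure (Or.inl ⟨v, hv, rfl⟩)
    intro g hg
    have hmem : rot g ∈ rot '' (Γ : Set (E n ≃ᵢ E n)) := ⟨g, hg, rfl⟩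
    have h1 : rot ((s (rot g))⁻¹ * g) = 1 := by rw [map_mul, map_inv, hs _ hmem]; simp
    have h2 := eq_translation_of_rot_eq_one h1
    have h3 : (s (rot g))⁻¹ * g ∈ Subgroup.closure F := by
      rw [h2]
      refine hT ?_
      rw [mem_translationLattice, ← h2]
      exact Γ.mul_mem (Γ.inv_mem (hsΓ _ hmem)) hg
    have h4 : s (rot g) ∈ Subgroup.closure F := Subgroup.subset_closure (Or.inr ⟨_, hmem, rfl⟩)
    simpa using Subgroup.mul_mem _ h4 h3

/-- Isometries near the identity which normalize a finitely generated discrete group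
centralize it. -/
theorem exists_nhds_isConjugationBy_eq_one {X : Type*} [PseudoMetricSpace X]
    {Γ : Subgroup (X ≃ᵢ X)} (hΓ : DiscreteTopology Γ) (hfg : Γ.FG) :
    ∃ U ∈ 𝓝 (1 : X ≃ᵢ X), ∀ g ∈ U, ∀ φ : MulAut Γ, IsConjugationBy (toPerm g) φ → φ = 1 := by
  have h1 : ({1} : Set Γ) ∈ 𝓝 (1 : Γ) := by simp
  rw [nhds_subtype, Filter.mem_comap] at h1
  obtain ⟨V, hV, hV1⟩ := h1
  obtain ⟨S, hS⟩ := hfg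
  -- For `g` normalizing `Γ`, its commutators with the finitely many generators lie in `Γ`; near the
  -- identity, discreteness makes them trivial.
  have hU : ∀ᶠ g in 𝓝 (1 : X ≃ᵢ X), ∀ γ ∈ S, g * γ * g⁻¹ * γ⁻¹ ∈ V := by
    rw [Filter.eventually_all_finset]
    intro γ _
    have hcont : Continuous fun g : X ≃ᵢ X => g * γ * g⁻¹ * γ⁻¹ := by fun_prop
    have := hcont.tendsto 1
    simp only [one_mul, inv_one, mul_one, mul_inv_cancel] at this
    exact this hV
  refine ⟨_, hU, fun g hg φ hφ => ?_⟩
  have hcen : Γ ≤ Subgroup.centralizer {g} := by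
    rw [← hS, Subgroup.closure_le]
    intro γ hγ
    have hγΓ : γ ∈ Γ := hS ▸ Subgroup.subset_closure hγ
    have e : (φ ⟨γ, hγΓ⟩ : X ≃ᵢ X) = g * γ * g⁻¹ :=
      toPerm_injective (by rw [hφ, map_mul, map_mul, map_inv])
    have hmem : φ ⟨γ, hγΓ⟩ * ⟨γ, hγΓ⟩⁻¹ ∈ ({1} : Set Γ) := hV1 (by
      change ((φ ⟨γ, hγΓ⟩ * ⟨γ, hγΓ⟩⁻¹ : Γ) : X ≃ᵢ X) ∈ V
      rw [Subgroup.coe_mul, e]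
      exact hg γ hγ)
    rw [Set.mem_singleton_iff, mul_inv_eq_one] at hmem
    rw [hmem, eq_mul_inv_iff_mul_eq] at e
    rw [SetLike.mem_coe, Subgroup.mem_centralizer_singleton_iff]
    exact e
  ext1 γ
  refine Subtype.ext (toPerm_injective ?_)
  have h2 := Subgroup.mem_centralizer_singleton_iff.1 (hcen γ.2)
  rw [hφ, ← map_inv, ← map_mul, ← map_mul, ← h2, mul_inv_cancel_right]; rfl

theorem exists_monoidHom_of_rel {G H : Type*} [Group G] [Group H] {R : G → H → Prop}
    (hex : ∀ g, ∃ h, R g h) (huniq : ∀ g h h', R g h → R g h' → h = h')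
    (hmul : ∀ g h g' h', R g h → R g' h' → R (g * g') (h * h')) :
    ∃ F : G →* H, ∀ g h, R g h ↔ F g = h := by
  choose f hf using hex
  refine ⟨MonoidHom.mk' f fun g g' => huniq _ _ _ (hf _) (hmul _ _ _ _ (hf g) (hf g')), ?_⟩
  intro g h
  exact ⟨fun hR => huniq _ _ _ (hf g) hR, fun e => e ▸ hf g⟩

end AffineRealization

/-! ### The two homomorphisms, their kernels, and finiteness -/

section OmegaMaps

variable {n : ℕ} {Γ : Subgroup (E n ≃ᵢ E n)}

theorem affine_toEquiv (g : E n ≃ᵢ E n) : (affine g).toEquiv = toPerm g :=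
  Equiv.ext fun x => affine_apply g x

theorem isLift_affine {g : E n ≃ᵢ E n} {β : OrbitSpace Γ → OrbitSpace Γ} (h : IsLift Γ g β) :
    IsLift Γ (affine g) β := fun x => by rw [affine_apply, h]

/-- If `φ` is conjugation by `γ`, then `γ⁻¹` composed with `α` is still a lift and commutes with the
whole group. -/
theorem exists_translation_lift (hd : IsProperlyDiscontinuous Γ) (hc : IsCocompact Γ)
    {α : E n ≃ᵃ[ℝ] E n} {β : OrbitSpace Γ → OrbitSpace Γ} (h : IsLift Γ α β) {φ : MulAut Γ}
    (hα : IsConjugationBy α.toEquiv φ) (hφ : φ ∈ Inn Γ) :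
    ∃ w, (∀ γ ∈ Γ, rot γ w = w) ∧ IsLift Γ (translation w) β := by
  obtain ⟨γ, rfl⟩ := hφ
  have h1 : IsConjugationBy (α.trans (affine (γ⁻¹ : Γ))).toEquiv (1 : MulAut Γ) := by
    have h2 := (IsConjugationBy.conj γ⁻¹).mul hα
    rw [← affine_toEquiv, ← map_mul, inv_mul_cancel, map_one] at h2
    exact h2
  obtain ⟨hx, hfix⟩ := eq_add_of_isConjugationBy_one hd hc h1
  refine ⟨_, hfix, fun x => ?_⟩
  rw [translation_apply, ← hx x, AffineEquiv.trans_apply, affine_apply, mk_apply (γ⁻¹).2, h]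

theorem exists_omega (hd : IsProperlyDiscontinuous Γ) (hc : IsCocompact Γ) :
    ∃ Ω : AffOrbit Γ →* Out Γ, IsOmega Ω ∧ Function.Surjective Ω ∧
      ∀ β : AffOrbit Γ, Ω β = 1 ↔ ∃ w, (∀ γ ∈ Γ, rot γ w = w) ∧
        IsLift Γ (translation w) (β : Equiv.Perm (OrbitSpace Γ)) := by
  obtain ⟨Ω, hΩ⟩ := exists_monoidHom_of_rel (G := AffOrbit Γ) (H := Out Γ)
    (R := fun β q => ∃ (α : E n ≃ᵃ[ℝ] E n) (φ : MulAut Γ),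
      IsLift Γ α (β : Equiv.Perm (OrbitSpace Γ)) ∧ IsConjugationBy α.toEquiv φ ∧ (φ : Out Γ) = q)
    (by
      rintro ⟨β, α, hα⟩
      obtain ⟨φ, hφ⟩ := exists_isConjugationBy_of_isLift hd hα
      exact ⟨_, α, φ, hα, hφ, rfl⟩)
    (by
      rintro β _ _ ⟨α, φ, hα, hφ, rfl⟩ ⟨α', φ', hα', hφ', rfl⟩
      exact QuotientGroup.eq.2 (class_eq_of_isLift hd hα hα' hφ hφ'))
    (by
      rintro β _ β' _ ⟨α, φ, hα, hφ, rfl⟩ ⟨α', φ', hα', hφ', rfl⟩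
      exact ⟨α'.trans α, φ * φ', hα.comp hα', hφ.mul hφ', rfl⟩)
  refine ⟨Ω, fun β α hα => ?_, fun q => ?_, fun β => ?_⟩
  · obtain ⟨φ, hφ⟩ := exists_isConjugationBy_of_isLift hd hα
    exact ⟨φ, hφ, (hΩ _ _).1 ⟨α, φ, hα, hφ, rfl⟩⟩
  · obtain ⟨φ, rfl⟩ := QuotientGroup.mk_surjective q
    obtain ⟨α, hα⟩ := exists_affineEquiv_of_mulAut hd hc φ
    obtain ⟨β, hβ⟩ := hα.exists_perm
    exact ⟨⟨β, α, hβ⟩, (hΩ _ _).1 ⟨α, φ, hβ, hα, rfl⟩⟩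
  · rw [← hΩ]
    constructor
    · rintro ⟨α, φ, hα, hφ, h1⟩
      exact exists_translation_lift hd hc hα hφ ((QuotientGroup.eq_one_iff φ).1 h1)
    · rintro ⟨w, hw, hβ⟩
      exact ⟨affine (translation w), 1, isLift_affine hβ,
        by rw [affine_toEquiv]; exact isConjugationBy_translation hw, rfl⟩

theorem exists_isConjugationBy_of_isLift_isom (hd : IsProperlyDiscontinuous Γ) {g : E n ≃ᵢ E n}
    {ζ : IsomOrbit Γ} (h : IsLift Γ g ζ) : ∃ φ : AutE Γ, IsConjugationBy (toPerm g) (φ : MulAut Γ) := by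
  obtain ⟨φ, hφ⟩ := exists_isConjugationBy_of_isLift hd (β := ζ.toEquiv) (isLift_affine h)
  rw [affine_toEquiv] at hφ
  exact ⟨⟨φ, g, hφ⟩, hφ⟩

theorem exists_omegaE (hd : IsProperlyDiscontinuous Γ) (hc : IsCocompact Γ) :
    ∃ Ω : IsomOrbit Γ →* OutE Γ, IsOmegaE Ω ∧ Function.Surjective Ω ∧
      ∀ ζ : IsomOrbit Γ, Ω ζ = 1 ↔ ∃ w, (∀ γ ∈ Γ, rot γ w = w) ∧
        IsLift Γ (translation w) ζ := by
  obtain ⟨Ω, hΩ⟩ := exists_monoidHom_of_rel (G := IsomOrbit Γ) (H := OutE Γ)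
    (R := fun ζ q => ∃ (g : E n ≃ᵢ E n) (φ : AutE Γ),
      IsLift Γ g ζ ∧ IsConjugationBy (toPerm g) (φ : MulAut Γ) ∧ (φ : OutE Γ) = q)
    (by
      intro ζ
      obtain ⟨g, hg⟩ := exists_isometric_lift hd ζ
      obtain ⟨φ, hφ⟩ := exists_isConjugationBy_of_isLift_isom hd hg
      exact ⟨_, g, φ, hg, hφ, rfl⟩)
    (by
      rintro ζ _ _ ⟨g, φ, hg, hφ, rfl⟩ ⟨g', φ', hg', hφ', rfl⟩
      rw [← affine_toEquiv] at hφ hφ'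
      exact QuotientGroup.eq.2 (class_eq_of_isLift hd (β := ζ.toEquiv) (isLift_affine hg)
        (isLift_affine hg') hφ hφ'))
    (by
      rintro ζ _ ζ' _ ⟨g, φ, hg, hφ, rfl⟩ ⟨g', φ', hg', hφ', rfl⟩
      exact ⟨g * g', φ * φ', hg.comp hg', by rw [map_mul]; exact hφ.mul hφ', rfl⟩)
  refine ⟨Ω, fun ζ g hg => ?_, fun q => ?_, fun ζ => ?_⟩
  · obtain ⟨φ, hφ⟩ := exists_isConjugationBy_of_isLift_isom hd hg
    exact ⟨φ, hφ, (hΩ _ _).1 ⟨g, φ, hg, hφ, rfl⟩⟩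
  · obtain ⟨⟨φ, g, hg⟩, rfl⟩ := QuotientGroup.mk_surjective q
    obtain ⟨ζ, hζ⟩ := hg.exists_isom
    exact ⟨ζ, (hΩ _ _).1 ⟨g, ⟨φ, g, hg⟩, hζ, hg, rfl⟩⟩
  · rw [← hΩ]
    constructor
    · rintro ⟨g, φ, hg, hφ, h1⟩
      rw [← affine_toEquiv] at hφ
      exact exists_translation_lift hd hc (isLift_affine hg) hφ
        (Subgroup.mem_subgroupOf.1 ((QuotientGroup.eq_one_iff φ).1 h1))
    · rintro ⟨w, hw, hζ⟩
      exact ⟨translation w, 1, hζ, isConjugationBy_translation hw, rfl⟩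

/-- By cocompactness, every class is represented by an isometry moving 0 at most `d`. Two
representatives that are close induce the same automorphism, so there are only finitely many. -/
theorem finite_outE (hdisc : DiscreteTopology Γ) (hc : IsCocompact Γ) : Finite (OutE Γ) := by
  have hd := isProperlyDiscontinuous_of_discreteTopology hdisc
  obtain ⟨U, hU, hU1⟩ := exists_nhds_isConjugationBy_eq_one hdisc (fg_of_isCocompact hd hc)
  obtain ⟨d, hcd⟩ := hc
  have hex : ∀ q : OutE Γ, ∃ (g : E n ≃ᵢ E n) (φ : AutE Γ), dist (g 0) 0 ≤ d ∧
      IsConjugationBy (toPerm g) (φ : MulAut Γ) ∧ (φ : OutE Γ) = q := by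
    intro q
    obtain ⟨⟨φ, g, hg⟩, rfl⟩ := QuotientGroup.mk_surjective q
    obtain ⟨γ, hγ, hγd⟩ := hcd (g⁻¹ 0)
    have hconj : MulAut.conj (⟨γ, hγ⟩ : Γ) ∈ Inn Γ := ⟨_, rfl⟩
    refine ⟨g * γ, ⟨φ, g, hg⟩ * ⟨MulAut.conj ⟨γ, hγ⟩, Inn_le_AutE Γ hconj⟩, ?_, ?_, ?_⟩
    · rwa [IsometryEquiv.mul_apply, ← g⁻¹.dist_eq, IsometryEquiv.inv_apply_self]
    · rw [map_mul]
      exact hg.mul (IsConjugationBy.conj ⟨γ, hγ⟩)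
    · refine (QuotientGroup.eq.2 ?_).symm
      rw [inv_mul_cancel_left]
      exact hconj
  choose g φ hgd hg hφ using hex
  have hfin : (Set.range g).Finite := by
    refine finite_of_separated_isom (x₀ := 0) (r := d) ?_ hU ?_
    · rintro _ ⟨q, rfl⟩; exact hgd q
    · rintro _ ⟨q, rfl⟩ _ ⟨q', rfl⟩ hqU
      have h1 := hU1 _ hqU ((φ q)⁻¹ * φ q' : AutE Γ) (by
        rw [map_mul, map_inv]; exact (hg q).inv.mul (hg q'))
      have h2 : φ q = φ q' := inv_mul_eq_one.1 (Subtype.ext h1)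
      rw [← hφ q, ← hφ q', h2]
  have := hfin.to_subtype
  refine Finite.of_injective (fun q => (⟨g q, q, rfl⟩ : Set.range g)) fun q q' h => ?_
  have h1 : g q = g q' := congrArg Subtype.val h
  have h2 := hg q
  rw [h1] at h2
  have h3 : φ q = φ q' := Subtype.ext (h2.unique (hg q'))
  rw [← hφ q, ← hφ q', h3]

/-- Isometries of the orbit space near the identity lift to isometries near the identity. -/
theorem eventually_exists_lift_mem (hd : IsProperlyDiscontinuous Γ) {U : Set (E n ≃ᵢ E n)}
    (hU : U ∈ 𝓝 1) : ∀ᶠ ζ : IsomOrbit Γ in 𝓝 1, ∃ g ∈ U, IsLift Γ g ζ := by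
  obtain ⟨p, -, hp⟩ := exists_trivial_stabilizer hd isOpen_univ ⟨(0 : E n), trivial⟩
  obtain ⟨r, hr, -, hrd⟩ := exists_injectivity_radius hd hp
  -- Correcting a lift by an element of `Γ` makes it move `p` exactly as far as `ζ` moves the orbit
  -- of `p`.
  have hex : ∀ ζ : IsomOrbit Γ, ∃ g : E n ≃ᵢ E n, IsLift Γ g ζ ∧
      dist (g p) p = dist (ζ (OrbitSpace.mk Γ p)) (OrbitSpace.mk Γ p) := by
    intro ζ
    obtain ⟨g, hg⟩ := exists_isometric_lift hd ζ
    obtain ⟨γ, hγ, h⟩ := hd.exists_dist_eq (g p) p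
    refine ⟨γ * g, fun x => ?_, ?_⟩
    · rw [IsometryEquiv.mul_apply, mk_apply hγ, hg]
    · rw [hg, h]; rfl
  choose G hG hGp using hex
  have hζ : ∀ x, Filter.Tendsto (fun ζ : IsomOrbit Γ => dist (ζ (OrbitSpace.mk Γ x))
      (OrbitSpace.mk Γ x)) (𝓝 1) (𝓝 0) := fun x =>
    tendsto_iff_dist_tendsto_zero.1 (tendsto_isom_self (OrbitSpace.mk Γ x) (1 : IsomOrbit Γ))
  have hp0 : Filter.Tendsto (fun ζ : IsomOrbit Γ => G ζ p) (𝓝 1) (𝓝 p) := by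
    rw [tendsto_iff_dist_tendsto_zero]
    simpa only [hGp] using hζ p
  have hball : ∀ x ∈ Metric.ball p (r / 2),
      Filter.Tendsto (fun ζ : IsomOrbit Γ => G ζ x) (𝓝 1) (𝓝 x) := by
    intro x hx
    rw [tendsto_iff_dist_tendsto_zero]
    refine (hζ x).congr' ?_
    filter_upwards [hp0 (Metric.ball_mem_nhds p (half_pos hr))] with ζ hζp
    rw [hG ζ x]
    rw [Set.mem_preimage, Metric.mem_ball] at hζp
    rw [Metric.mem_ball] at hx
    refine hrd _ ?_ _ ?_
    · rw [Metric.mem_ball]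
      have := dist_triangle (G ζ x) (G ζ p) p
      rw [(G ζ).dist_eq] at this
      linarith
    · rw [Metric.mem_ball]; linarith
  have hall : Filter.Tendsto G (𝓝 1) (𝓝 1) := by
    refine tendsto_isom_iff.2 fun y => ?_
    have hlim : Filter.Tendsto (fun t : ℝ => AffineMap.lineMap p y t) (𝓝[≠] 0) (𝓝 p) := by
      have : Filter.Tendsto (fun t : ℝ => AffineMap.lineMap p y t) (𝓝 0)
          (𝓝 (AffineMap.lineMap p y (0 : ℝ))) :=
        (AffineMap.lineMap_continuous (p := p) (q := y)).tendsto 0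
      rw [AffineMap.lineMap_apply_zero] at this
      exact this.mono_left nhdsWithin_le_nhds
    obtain ⟨t, ht, ht0⟩ := ((hlim.eventually (Metric.ball_mem_nhds p (half_pos hr))).and
      self_mem_nhdsWithin).exists
    have hxt : (AffineMap.lineMap p y t : E n) - p = t • (y - p) := by
      rw [AffineMap.lineMap_apply]; simp
    -- An isometry is affine, so its value at `y` is determined by its values at `p` and at a point
    -- of the line through `p` and `y` near `p`, where convergence is known.
    have hform : ∀ g : E n ≃ᵢ E n, g y = g p + t⁻¹ • (g (AffineMap.lineMap p y t) - g p) := by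
      intro g
      rw [apply_sub_apply, hxt, map_smul, inv_smul_smul₀ ht0, ← apply_sub_apply]; abel
    have h1 := hp0.add (((hball _ ht).sub hp0).const_smul t⁻¹)
    rw [hxt, inv_smul_smul₀ ht0, add_sub_cancel] at h1
    exact h1.congr fun ζ => (hform _).symm
  filter_upwards [hall hU] with ζ hζU
  exact ⟨G ζ, hζU, hG ζ⟩

/-- The condition on the right describes the kernel of the map to `OutE Γ`, an open and hence clopen
subgroup; in the other direction, scaling `w` from 0 to 1 joins the identity to `ζ`. -/
theorem mem_idComponent_iff (hdisc : DiscreteTopology Γ) (hc : IsCocompact Γ) (ζ : IsomOrbit Γ) :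
    ζ ∈ IdComponent Γ ↔ ∃ w, (∀ γ ∈ Γ, rot γ w = w) ∧ IsLift Γ (translation w) ζ := by
  have hd := isProperlyDiscontinuous_of_discreteTopology hdisc
  constructor
  · intro hζ
    obtain ⟨Ω, hΩ, -, hker⟩ := exists_omegaE hd hc
    rw [← hker]
    obtain ⟨U, hU, hU1⟩ := exists_nhds_isConjugationBy_eq_one hdisc (fg_of_isCocompact hd hc)
    have hopen : IsOpen (Ω.ker : Set (IsomOrbit Γ)) := by
      refine Subgroup.isOpen_of_mem_nhds _ (g := 1) ?_
      filter_upwards [eventually_exists_lift_mem hd hU] with ζ hζ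
      obtain ⟨g, hgU, hg⟩ := hζ
      obtain ⟨φ, hφ, e⟩ := hΩ ζ g hg
      have : φ = 1 := Subtype.ext (hU1 g hgU φ hφ)
      rw [SetLike.mem_coe, MonoidHom.mem_ker, e, this]; rfl
    exact IsClopen.connectedComponent_subset ⟨Subgroup.isClosed_of_isOpen _ hopen, hopen⟩
      Ω.ker.one_mem hζ
  · rintro ⟨w, hw, hζ⟩
    have hex : ∀ s : ℝ, ∃ ξ : IsomOrbit Γ, IsLift Γ (translation (s • w)) ξ := fun s =>
      (isConjugationBy_translation (w := s • w) fun γ hγ => by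
        rw [map_smul, hw γ hγ]).exists_isom
    choose F hF using hex
    have hcont : Continuous F := by
      rw [continuous_iff_continuousAt]
      intro s
      refine tendsto_isom_iff.2 fun q => ?_
      obtain ⟨x, rfl⟩ := OrbitSpace.mk_surjective q
      simp only [hF _ x, translation_apply]
      have : Continuous fun s : ℝ => OrbitSpace.mk Γ (x + s • w) :=
        continuous_mk.comp (by fun_prop)
      exact this.tendsto s
    have h0 : F 0 = 1 := IsometryEquiv.ext fun q => by
      obtain ⟨x, rfl⟩ := OrbitSpace.mk_surjective q
      rw [hF 0 x]; simp
    have h1 : F 1 = ζ := IsometryEquiv.ext fun q => by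
      obtain ⟨x, rfl⟩ := OrbitSpace.mk_surjective q
      rw [hF 1 x, hζ x, one_smul]
    exact (isPreconnected_range hcont).subset_connectedComponent ⟨0, h0⟩ ⟨1, h1⟩

end OmegaMaps

end SpaceGroup

theorem theorem13 (n : ℕ) (Γ : Subgroup (E n ≃ᵢ E n)) (hΓ : IsSpaceGroup Γ) :
    (∃ Ω : AffOrbit Γ →* Out Γ, IsOmega Ω ∧ Function.Surjective Ω ∧
      Ω.ker.map (AffOrbit Γ).subtype = (IdComponent Γ).map toPerm) ∧
    ((∀ ζ : IsomOrbit Γ, ∃ g : E n ≃ᵢ E n, IsLift Γ g ζ) ∧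
      (∃ Ω : IsomOrbit Γ →* OutE Γ, IsOmegaE Ω ∧ Function.Surjective Ω ∧ Ω.ker = IdComponent Γ) ∧
      Finite (OutE Γ)) := by
  have hd := isProperlyDiscontinuous_of_discreteTopology hΓ.discrete
  have hc := isCocompact_of_compactSpace hΓ.compact
  have hcomp := mem_idComponent_iff hΓ.discrete hc
  refine ⟨?_, exists_isometric_lift hd, ?_, finite_outE hΓ.discrete hc⟩
  · obtain ⟨Ω, hΩ, hsurj, hker⟩ := exists_omega hd hc
    refine ⟨Ω, hΩ, hsurj, ?_⟩
    ext β
    simp only [Subgroup.mem_map, MonoidHom.mem_ker, hker, hcomp]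
    constructor
    · rintro ⟨β, ⟨w, hw, hβ⟩, rfl⟩
      -- A bijection lifted by such a translation is automatically an isometry of the orbit space,
      -- because maps with the same lift coincide.
      obtain ⟨ζ, hζ⟩ := (isConjugationBy_translation hw).exists_isom
      exact ⟨ζ, ⟨w, hw, hζ⟩, Equiv.ext fun q => congrFun (hζ.eq_of_eq hβ) q⟩
    · rintro ⟨ζ, ⟨w, hw, hζ⟩, rfl⟩
      exact ⟨⟨toPerm ζ, affine (translation w), isLift_affine hζ⟩, ⟨w, hw, hζ⟩, rfl⟩
  · obtain ⟨Ω, hΩ, hsurj, hker⟩ := exists_omegaE hd hc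
    refine ⟨Ω, hΩ, hsurj, ?_⟩
    ext ζ
    rw [MonoidHom.mem_ker, hker, hcomp]
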